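/- **Setting.** On the Riemann sphere $\mathbb{CP}(1)$, with affine coordinate $w\mapsto[1:w]$, let $\Omega=\frac{i}{(1+|w|^2)^2}\,dw\wedge d\bar w$ be the Fubini–Study form, which has total mass $2\pi$, and let $\mu=\frac1{2\pi}\Omega$ be the normalized area measure. For $m\ge 0$ let $\mathbf L^{\otimes m}$ be the $m$-th power of the hyperplane bundle. In the coordinate $w$, its square-integrable sections form the Hilbert space $\Gamma^m_2$ with inner product $\int s_1\overline{s_2}\,(1+|w|^2)^{-m}\,d\Omega$, and its holomorphic sections form the subspace $\Gamma^m_{hol}=\mathrm{span}\{1,w,\dots,w^m\}$. Let $P^m:\Gamma^m_2\to\Gamma^m_{hol}$ be the orthogonal projection. The Toeplitz quantization of a real function $f\in C^\infty(\mathbb{CP}(1))$ is the operator $T^m_f=P^m\circ M_f\circ P^m$ on $\Gamma^m_{hol}$, where $M_f$ is multiplication by $f$. It is self-adjoint; let $\lambda^m=(\lambda^m_0,\dots,\lambda^m_m)$ be its eigenvalues, counted with multiplicity, in non-increasing order. For a real measurable function $h$ on a probability space $(X,\nu)$, the decreasing rearrangement is $h^*(s)=\inf\{t\in\mathbb R :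 \nu\{h\ge t\}<s\}$, $0<s\le 1$. For integrable $g,h$, write $g\prec h$ if $\int_0^s g^*\le\int_0^s h^*$ for all $0\le s<1$ and $\int_0^1 g^*=\int_0^1 h^*$. Let $f^*$ be the decreasing rearrangement of $f$ with respect to $\mu$, and let $\Omega(f^*)=\{g\in L^2([0,1]) : g\prec f^*\}$, where $L^2([0,1])$ is the real Hilbert space with respect to Lebesgue measure. Let $\mathrm{Smeas}(I)$ be the set of all (not necessarily invertible) Lebesgue measure preserving maps $\phi:[0,1]\to[0,1]$. Let $\Sigma_m\cdot\lambda^m$ be the set of all vectors obtained from $\lambda^m$ by permuting its $m+1$ coordinates, $co$ the convex hull in $\mathbb R^{m+1}$, and $p^m:\mathbb R^{m+1}\to L^2([0,1])$ the map $p^m(a_0,\dots,a_m)=\sum_{k=0}^m a_k\,\chi_{[k/(m+1),\,(k+1)/(m+1))}$. Put $E_m=p^m(co(\Sigma_m\cdot\lambda^m))$. The topological lim sup $Ls\,E_m$ is the set of all $x\in L^2([0,1])$ such that every norm neighborhood $V$ of $x$ satisfies $V\cap E_m\ne\emptyset$ for infinitely many $m$. **Theorem.** Let $f\in C^\infty(\mathbb{CP}(1))$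 be real-valued. Then the closure of $Ls\,E_m$ in the weak topology of $L^2([0,1])$ equals $\Omega(f^*)$, and the closed convex hull of $\mathrm{Smeas}(I)\cdot f^*=\{f^*\circ\phi : \phi\in\mathrm{Smeas}(I)\}$ in $L^2([0,1])$ equals the same set: $$\overline{co}\,(\mathrm{Smeas}(I)\cdot f^*)=\overline{Ls\,E_m}^{\,weak}=\Omega(f^*).$$ -/

import Mathlib

open MeasureTheory Set Filter Topology
open scoped ENNReal ContDiff unitInterval

noncomputable section

namespace ToeplitzConvexity

/-! ### The Riemann sphere, its smooth functions and its area measure -/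

/-- The complex projective line, as the set of lines through the origin of `ℂ²`. -/
def CP1 : Type := Projectivization ℂ (Fin 2 → ℂ)

/-- The quotient topology of `ℂ² ∖ {0}`. -/
instance : TopologicalSpace CP1 :=
  TopologicalSpace.coinduced (fun v : {v : Fin 2 → ℂ // v ≠ 0} => Projectivization.mk' ℂ v)
    inferInstance

instance : MeasurableSpace CP1 := borel CP1

instance : BorelSpace CP1 := ⟨rfl⟩

/-- The affine coordinate `w ↦ [1 : w]`. -/
def affineChart (w : ℂ) : CP1 :=
  Projectivization.mk ℂ ![1, w] (fun h => one_ne_zero (congrFun h 0))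

/-- The affine coordinate at the other pole, `u ↦ [u : 1]`. -/
def affineChartInfty (u : ℂ) : CP1 :=
  Projectivization.mk ℂ ![u, 1] (fun h => one_ne_zero (congrFun h 1))

/-- `f` is a real-valued `C^∞` function on `ℂP(1)`: it is smooth (in the real sense) in each of
the two affine coordinates, which form an atlas of `ℂP(1)`. -/
def IsSmooth (f : CP1 → ℝ) : Prop :=
  ContDiff ℝ ∞ (fun w : ℂ => f (affineChart w)) ∧
    ContDiff ℝ ∞ (fun u : ℂ => f (affineChartInfty u))

/-- The measure on the affine coordinate plane given by the Fubini-Study form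
`Ω = i dw ∧ dw̄ / (1 + |w|²)² = 2 dx ∧ dy / (1 + |w|²)²`. -/
def fubiniStudy : Measure ℂ :=
  (volume : Measure ℂ).withDensity (fun w => ENNReal.ofReal (2 / (1 + ‖w‖ ^ 2) ^ 2))

/-- The normalized area measure `Ω / 2π` on `ℂP(1)` (the complement of the affine coordinate plane
is one point, which has area zero). -/
def areaMeasure : Measure CP1 :=
  ENNReal.ofReal (1 / (2 * Real.pi)) • fubiniStudy.map affineChart

/-! ### Decreasing rearrangement and majorization -/

/-- The distribution function `F_f(t) = μ {f < t}`. -/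
def distributionFunction {X : Type*} [MeasurableSpace X] (μ : Measure X) (f : X → ℝ) (t : ℝ) : ℝ :=
  μ.real {x | f x < t}

/-- The decreasing rearrangement `f^*(s) = inf {t | d_f(t) < s}`, where
`d_f(t) = μ(X) - F_f(t)`. Here `t` ranges over all of `ℝ`, as `f` need not be nonnegative. -/
def decreasingRearrangement {X : Type*} [MeasurableSpace X] (μ : Measure X) (f : X → ℝ) (s : ℝ) :
    ℝ :=
  sInf {t : ℝ | μ.real univ - distributionFunction μ f t < s}

/-- `g ≺ f`, that is, `f` majorizes `g`. -/
def IsMajorizedBy {X : Type*} [MeasurableSpace X] (μ : Measure X) (g f : X → ℝ) : Prop :=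
  (∀ s ∈ Ico (0 : ℝ) 1, ∫ z in (0 : ℝ)..s, decreasingRearrangement μ g z ≤
      ∫ z in (0 : ℝ)..s, decreasingRearrangement μ f z) ∧
    ∫ z in (0 : ℝ)..1, decreasingRearrangement μ g z =
      ∫ z in (0 : ℝ)..1, decreasingRearrangement μ f z

/-- The real Hilbert space `L²([0,1])`. -/
abbrev L2I : Type := Lp ℝ 2 (volume : Measure I)

/-- The decreasing rearrangement of a function on `ℂP(1)`, as a function on `[0,1]`. -/
def rearr (f : CP1 → ℝ) (s : I) : ℝ := decreasingRearrangement areaMeasure f s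

/-- `Ω(f^*) = {g ∈ L²([0,1]) | g ≺ f^*}`. -/
def majorizedSet (f : CP1 → ℝ) : Set L2I :=
  {g | IsMajorizedBy (volume : Measure I) g (rearr f)}

/-! ### Basic facts on the area measure -/

theorem continuous_affineChart : Continuous affineChart := by
  have h : Continuous (fun v : {v : Fin 2 → ℂ // v ≠ 0} =>
      show CP1 from Projectivization.mk' ℂ v) := continuous_coinduced_rng
  have h2 : Continuous (fun w : ℂ =>
      (⟨![1, w], fun h => one_ne_zero (congrFun h 0)⟩ : {v : Fin 2 → ℂ // v ≠ 0})) := by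
    refine Continuous.subtype_mk ?_ _
    refine continuous_pi fun i => ?_
    fin_cases i
    · exact continuous_const
    · exact continuous_id
  exact h.comp h2

theorem measurable_fubiniStudy_density :
    Measurable (fun w : ℂ => ENNReal.ofReal (2 / (1 + ‖w‖ ^ 2) ^ 2)) := by
  fun_prop

theorem integrable_and_integral_radial :
    IntegrableOn (fun r : ℝ => r * (2 / (1 + r ^ 2) ^ 2)) (Ioi 0) ∧
      ∫ r in Ioi (0 : ℝ), r * (2 / (1 + r ^ 2) ^ 2) = 1 := by
  have hd : ∀ x ∈ Ici (0 : ℝ), HasDerivAt (fun r : ℝ => -(1 + r ^ 2)⁻¹)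
      (x * (2 / (1 + x ^ 2) ^ 2)) x := by
    intro x _
    have h0 : (1 + x ^ 2) ≠ 0 := by positivity
    have h1 : HasDerivAt (fun r : ℝ => 1 + r ^ 2) (2 * x) x := by
      simpa using (hasDerivAt_pow 2 x).const_add 1
    have h2 : x * (2 / (1 + x ^ 2) ^ 2) = -(-(2 * x) / (1 + x ^ 2) ^ 2) := by ring
    rw [h2]
    exact (h1.fun_inv h0).fun_neg
  have ht : Tendsto (fun r : ℝ => -(1 + r ^ 2)⁻¹) atTop (𝓝 0) := by
    have : Tendsto (fun r : ℝ => 1 + r ^ 2) atTop atTop :=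
      tendsto_atTop_add_const_left _ _ (tendsto_pow_atTop two_ne_zero)
    simpa using this.inv_tendsto_atTop.neg
  have hpos : ∀ x ∈ Ioi (0 : ℝ), 0 ≤ x * (2 / (1 + x ^ 2) ^ 2) := by
    intro x hx
    have : (0 : ℝ) < x := hx
    positivity
  refine ⟨integrableOn_Ioi_deriv_of_nonneg' hd hpos ht, ?_⟩
  rw [integral_Ioi_of_hasDerivAt_of_nonneg' hd hpos ht]
  norm_num

theorem fubiniStudy_univ : fubiniStudy univ = ENNReal.ofReal (2 * Real.pi) := by
  have hR := integrable_and_integral_radial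
  rw [fubiniStudy, withDensity_apply _ MeasurableSet.univ, Measure.restrict_univ,
    ← Complex.lintegral_comp_polarCoord_symm]
  have : ∀ p ∈ polarCoord.target, ENNReal.ofReal p.1 •
      ENNReal.ofReal (2 / (1 + ‖Complex.polarCoord.symm p‖ ^ 2) ^ 2) =
        ENNReal.ofReal (p.1 * (2 / (1 + p.1 ^ 2) ^ 2)) * 1 := by
    intro p hp
    have hp1 : 0 < p.1 := by
      rw [polarCoord_target] at hp
      exact hp.1
    rw [Complex.norm_polarCoord_symm, sq_abs, smul_eq_mul, ← ENNReal.ofReal_mul hp1.le, mul_one]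
  rw [setLIntegral_congr_fun polarCoord.open_target.measurableSet this, polarCoord_target,
    Measure.volume_eq_prod, ← Measure.prod_restrict,
    lintegral_prod_mul (f := fun r : ℝ => ENNReal.ofReal (r * (2 / (1 + r ^ 2) ^ 2)))
      (g := fun _ => 1) (by fun_prop) (by fun_prop),
    ← ofReal_integral_eq_lintegral_ofReal hR.1, hR.2]
  · rw [ENNReal.ofReal_one, one_mul, lintegral_one, Measure.restrict_apply_univ,
      Real.volume_Ioo]
    ring_nf
  · filter_upwards [ae_restrict_mem measurableSet_Ioi] with x hx
    have : (0 : ℝ) < x := hx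
    positivity

instance : IsFiniteMeasure fubiniStudy := ⟨by rw [fubiniStudy_univ]; exact ENNReal.ofReal_lt_top⟩

instance : IsProbabilityMeasure areaMeasure := ⟨by
  rw [areaMeasure, Measure.smul_apply, Measure.map_apply continuous_affineChart.measurable
    MeasurableSet.univ, preimage_univ, fubiniStudy_univ, smul_eq_mul,
    ← ENNReal.ofReal_mul (by positivity), one_div,
    inv_mul_cancel₀ (by positivity), ENNReal.ofReal_one]⟩

theorem IsSmooth.bounded {f : CP1 → ℝ} (hf : IsSmooth f) : ∃ C : ℝ, 0 ≤ C ∧ ∀ p, |f p| ≤ C := by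
  obtain ⟨C₀, h₀⟩ := (isCompact_closedBall (0 : ℂ) 1).exists_bound_of_continuousOn
    hf.1.continuous.continuousOn
  obtain ⟨C₁, h₁⟩ := (isCompact_closedBall (0 : ℂ) 1).exists_bound_of_continuousOn
    hf.2.continuous.continuousOn
  simp only [mem_closedBall_zero_iff, Real.norm_eq_abs] at h₀ h₁
  refine ⟨max C₀ C₁, ?_, fun p => ?_⟩
  · exact ((abs_nonneg _).trans (h₀ 0 (by simp))).trans (le_max_left _ _)
  · induction p using Projectivization.ind with
    | h v hv =>
      by_cases hle : ‖v 1‖ ≤ ‖v 0‖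
      · have hne : v 0 ≠ 0 := by
          intro h0
          apply hv
          have h1 : v 1 = 0 := by simpa [h0] using hle
          ext i
          fin_cases i
          · exact h0
          · exact h1
        have hp : (Projectivization.mk ℂ v hv : CP1) = affineChart (v 1 / v 0) := by
          refine (Projectivization.mk_eq_mk_iff' _ _ _ _ _).2 ⟨v 0, ?_⟩
          ext i
          fin_cases i
          · simp
          · simp [mul_div_cancel₀, hne]
        rw [hp]
        refine (h₀ _ ?_).trans (le_max_left _ _)
        rw [norm_div]
        exact div_le_one_of_le₀ hle (norm_nonneg _)
      · have hne : v 1 ≠ 0 := by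
          intro h0
          simp [h0] at hle
        have hp : (Projectivization.mk ℂ v hv : CP1) = affineChartInfty (v 0 / v 1) := by
          refine (Projectivization.mk_eq_mk_iff' _ _ _ _ _).2 ⟨v 1, ?_⟩
          ext i
          fin_cases i
          · simp [mul_div_cancel₀, hne]
          · simp
        rw [hp]
        refine (h₁ _ ?_).trans (le_max_right _ _)
        rw [norm_div]
        exact div_le_one_of_le₀ (not_le.1 hle).le (norm_nonneg _)

/-! ### The orbit of `f^*` under measure preserving transformations -/

theorem decreasingRearrangement_mem {f : CP1 → ℝ} {C : ℝ} (hC : ∀ p, |f p| ≤ C) {s : ℝ}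
    (hs : s ∈ Ioc (0 : ℝ) 1) :
    C + 1 ∈ {t : ℝ | areaMeasure.real univ - distributionFunction areaMeasure f t < s} ∧
      -C ∈ lowerBounds
        {t : ℝ | areaMeasure.real univ - distributionFunction areaMeasure f t < s} := by
  constructor
  · have : {x | f x < C + 1} = univ :=
      eq_univ_of_forall fun x => (le_abs_self _).trans_lt ((hC x).trans_lt (lt_add_one C))
    simp only [mem_ofPred_eq, distributionFunction, this, sub_self]
    exact hs.1
  · intro t ht
    by_contra! hlt
    have : {x | f x < t} = ∅ :=
      eq_empty_of_forall_notMem fun x hx => by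
        have h1 := (abs_le.1 (hC x)).1
        have h2 : f x < t := hx
        linarith
    simp only [mem_ofPred_eq, distributionFunction, this, measureReal_empty, sub_zero,
      probReal_univ] at ht
    exact absurd ht (not_lt.2 hs.2)

theorem IsSmooth.memLp_rearr {f : CP1 → ℝ} (hf : IsSmooth f) :
    MemLp (rearr f) 2 (volume : Measure I) := by
  obtain ⟨C, hC0, hC⟩ := hf.bounded
  have hanti : AntitoneOn (decreasingRearrangement areaMeasure f) (Ioc 0 1) := by
    intro a ha b hb hab
    exact csInf_le_csInf ⟨-C, (decreasingRearrangement_mem hC hb).2⟩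
      ⟨C + 1, (decreasingRearrangement_mem hC ha).1⟩ fun t ht => lt_of_lt_of_le ht hab
  have hmeas : AEMeasurable (decreasingRearrangement areaMeasure f)
      ((volume : Measure ℝ).restrict I) := by
    have h1 := aemeasurable_restrict_of_antitoneOn (μ := (volume : Measure ℝ))
      measurableSet_Ioc hanti
    rwa [restrict_Ioc_eq_restrict_Icc] at h1
  refine MemLp.of_bound (C := C + 1) ?_ ?_
  · exact (hmeas.comp_quasiMeasurePreserving
      unitInterval.measurePreserving_coe.quasiMeasurePreserving).aestronglyMeasurable
  · refine Eventually.of_forall fun s => ?_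
    rcases eq_or_lt_of_le s.2.1 with h0 | h0
    · have he : {t : ℝ | areaMeasure.real univ - distributionFunction areaMeasure f t < s} = ∅ := by
        refine eq_empty_of_forall_notMem fun t ht => ?_
        have h2 : areaMeasure.real univ - distributionFunction areaMeasure f t < s := ht
        have h3 : distributionFunction areaMeasure f t ≤ areaMeasure.real univ :=
          measureReal_mono (subset_univ _)
        rw [← h0] at h2
        linarith
      rw [rearr, decreasingRearrangement, he, Real.sInf_empty, norm_zero]
      linarith
    · have hm := decreasingRearrangement_mem hC (s := s) ⟨h0, s.2.2⟩
      rw [Real.norm_eq_abs, abs_le]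
      constructor
      · exact (by linarith : -(C + 1) ≤ -C).trans (le_csInf ⟨_, hm.1⟩ hm.2)
      · exact csInf_le ⟨_, hm.2⟩ hm.1

/-- `f^*` as an element of `L²([0,1])`. -/
def rearrL2 (f : CP1 → ℝ) (hf : IsSmooth f) : L2I := hf.memLp_rearr.toLp (rearr f)

/-- `Smeas(I) · f^* = {f^* ∘ φ | φ ∈ Smeas(I)}`, where `Smeas(I)` is the set of all (not necessarily
invertible) measure preserving transformations of `[0,1]`. -/
def smeasOrbit (f : CP1 → ℝ) (hf : IsSmooth f) : Set L2I :=
  {g | ∃ (φ : I → I) (hφ : MeasurePreserving φ volume volume),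
    g = Lp.compMeasurePreserving φ hφ (rearrL2 f hf)}

/-! ### Toeplitz quantization -/

/-- The weight `Ω / (1 + |w|²)^m`, so that `∫ s₁ s̄₂ / (1 + |w|²)^m dΩ` is the inner product of the
sections of `L^{⊗m}` given by `s₁`, `s₂` in the affine coordinate. -/
def sectionMeasure (m : ℕ) : Measure ℂ :=
  fubiniStudy.withDensity (fun w => ENNReal.ofReal (1 / (1 + ‖w‖ ^ 2) ^ m))

/-- The Hilbert space of square-integrable sections of `L^{⊗m}`, in the affine coordinate. -/
abbrev L2Sections (m : ℕ) : Type := Lp ℂ 2 (sectionMeasure m)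

theorem memLp_monomial (m : ℕ) (k : Fin (m + 1)) :
    MemLp (fun w : ℂ => w ^ (k : ℕ)) 2 (sectionMeasure m) := by
  refine ⟨(by fun_prop : Continuous fun w : ℂ => w ^ (k : ℕ)).aestronglyMeasurable, ?_⟩
  rw [eLpNorm_lt_top_iff_lintegral_rpow_enorm_lt_top two_ne_zero ENNReal.ofNat_ne_top,
    sectionMeasure, lintegral_withDensity_eq_lintegral_mul _ (by fun_prop) (by fun_prop)]
  refine lt_of_le_of_lt (lintegral_mono (g := fun _ => 1) fun w => ?_) (by simp)
  simp only [Pi.mul_apply, ENNReal.toReal_ofNat, ENNReal.rpow_ofNat]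
  rw [← ofReal_norm, ← ENNReal.ofReal_pow (norm_nonneg _),
    ← ENNReal.ofReal_mul (by positivity), ← ENNReal.ofReal_one]
  refine ENNReal.ofReal_le_ofReal ?_
  rw [norm_pow, one_div, inv_mul_le_one₀ (by positivity), ← pow_mul, mul_comm, pow_mul]
  calc (‖w‖ ^ 2) ^ (k : ℕ) ≤ (1 + ‖w‖ ^ 2) ^ (k : ℕ) := by gcongr; linarith
    _ ≤ (1 + ‖w‖ ^ 2) ^ m :=
      pow_le_pow_right₀ (by nlinarith [sq_nonneg ‖w‖]) (Nat.lt_succ_iff.1 k.2)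

/-- The holomorphic section `w^k` of `L^{⊗m}`, for `0 ≤ k ≤ m`. -/
def monomialSection (m : ℕ) (k : Fin (m + 1)) : L2Sections m :=
  (memLp_monomial m k).toLp (fun w : ℂ => w ^ (k : ℕ))

/-- The space of holomorphic sections of `L^{⊗m}`: the span of `1, w, …, w^m`. -/
def holSections (m : ℕ) : Submodule ℂ (L2Sections m) :=
  Submodule.span ℂ (range (monomialSection m))

instance (m : ℕ) : FiniteDimensional ℂ (holSections m) :=
  FiniteDimensional.span_of_finite ℂ (finite_range _)

theorem volume_absolutelyContinuous (m : ℕ) : (volume : Measure ℂ) ≪ sectionMeasure m := by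
  refine (withDensity_absolutelyContinuous' (μ := (volume : Measure ℂ))
    measurable_fubiniStudy_density.aemeasurable
    (Eventually.of_forall fun w => ?_)).trans
    (withDensity_absolutelyContinuous' (μ := fubiniStudy) (by fun_prop)
      (Eventually.of_forall fun w => ?_))
  · exact (ENNReal.ofReal_pos.2 (by positivity)).ne'
  · exact (ENNReal.ofReal_pos.2 (by positivity)).ne'

instance (m : ℕ) : (sectionMeasure m).IsOpenPosMeasure :=
  (volume_absolutelyContinuous m).isOpenPosMeasure

theorem linearIndependent_monomialSection (m : ℕ) :
    LinearIndependent ℂ (monomialSection m) := by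
  rw [Fintype.linearIndependent_iff]
  intro c hc
  have h1 : (fun w : ℂ => ∑ k : Fin (m + 1), c k * w ^ (k : ℕ)) =ᵐ[sectionMeasure m]
      fun _ => 0 := by
    have hk : ∀ᵐ w ∂(sectionMeasure m), ∀ k : Fin (m + 1),
        (c k • monomialSection m k : L2Sections m) w = c k * w ^ (k : ℕ) := by
      rw [ae_all_iff]
      intro k
      filter_upwards [Lp.coeFn_smul (c k) (monomialSection m k),
        (memLp_monomial m k).coeFn_toLp] with w h1 h2
      rw [h1, Pi.smul_apply, monomialSection, h2, smul_eq_mul]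
    have hz : ((∑ k, c k • monomialSection m k : L2Sections m) : ℂ → ℂ)
        =ᵐ[sectionMeasure m] fun _ => 0 := by
      rw [hc]
      exact Lp.coeFn_zero _ _ _
    filter_upwards [hk, hz, Lp.coeFn_finsetSum Finset.univ
      (fun k => c k • monomialSection m k)] with w h1 h2 h3
    rw [h3, Finset.sum_apply] at h2
    rw [← h2]
    exact Finset.sum_congr rfl fun k _ => (h1 k).symm
  have h2 := (Continuous.ae_eq_iff_eq (sectionMeasure m) (by fun_prop) (by fun_prop)).1 h1
  have h3 : (∑ k : Fin (m + 1), Polynomial.monomial (k : ℕ) (c k)) = 0 := by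
    refine Polynomial.funext fun w => ?_
    have := congrFun h2 w
    simpa [Polynomial.eval_finsetSum] using this
  intro i
  have := congrArg (fun p => Polynomial.coeff p (i : ℕ)) h3
  simpa [Polynomial.finsetSum_coeff, Polynomial.coeff_monomial, Fin.val_inj] using this

theorem finrank_holSections (m : ℕ) : Module.finrank ℂ (holSections m) = m + 1 := by
  rw [holSections, finrank_span_eq_card (linearIndependent_monomialSection m), Fintype.card_fin]

theorem IsSmooth.memLp_mul {f : CP1 → ℝ} (hf : IsSmooth f) {m : ℕ} (s : L2Sections m) :
    MemLp (fun w => (f (affineChart w) : ℂ) * s w) 2 (sectionMeasure m) := by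
  obtain ⟨C, -, hC⟩ := hf.bounded
  refine MemLp.of_le_mul (c := C) (Lp.memLp s) ?_ (Eventually.of_forall fun w => ?_)
  · exact (Complex.continuous_ofReal.comp hf.1.continuous).aestronglyMeasurable.mul
      (Lp.aestronglyMeasurable s)
  · rw [norm_mul, Complex.norm_real, Real.norm_eq_abs]
    gcongr
    exact hC _

/-- The operator `M_f` of multiplication by `f` on square-integrable sections. -/
def mulOperator (f : CP1 → ℝ) (hf : IsSmooth f) (m : ℕ) : L2Sections m →ₗ[ℂ] L2Sections m where
  toFun s := (hf.memLp_mul s).toLp (fun w => (f (affineChart w) : ℂ) * s w)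
  map_add' s t := by
    rw [← MemLp.toLp_add, MemLp.toLp_eq_toLp_iff]
    filter_upwards [Lp.coeFn_add s t] with w hw
    simp only [hw, Pi.add_apply, mul_add]
  map_smul' c s := by
    rw [RingHom.id_apply, ← MemLp.toLp_const_smul, MemLp.toLp_eq_toLp_iff]
    filter_upwards [Lp.coeFn_smul c s] with w hw
    simp only [hw, Pi.smul_apply, smul_eq_mul]
    ring

/-- The Toeplitz quantization `T_f^m = P^m ∘ M_f ∘ P^m` on the space of holomorphic sections,
where `P^m` is the orthogonal projection onto that space. -/
def toeplitz (f : CP1 → ℝ) (hf : IsSmooth f) (m : ℕ) : holSections m →ₗ[ℂ] holSections m :=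
  (holSections m).orthogonalProjectionOnto.toLinearMap ∘ₗ mulOperator f hf m ∘ₗ (holSections m).subtype

theorem toeplitz_isSymmetric (f : CP1 → ℝ) (hf : IsSmooth f) (m : ℕ) :
    (toeplitz f hf m).IsSymmetric := by
  intro s t
  change inner ℂ ((holSections m).orthogonalProjectionOnto (mulOperator f hf m s)) t =
    inner ℂ s ((holSections m).orthogonalProjectionOnto (mulOperator f hf m t))
  rw [Submodule.inner_orthogonalProjectionOnto_eq_of_mem_right,
    Submodule.inner_orthogonalProjectionOnto_eq_of_mem_left, L2.inner_def, L2.inner_def]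
  refine integral_congr_ae ?_
  filter_upwards [(hf.memLp_mul (s : L2Sections m)).coeFn_toLp,
    (hf.memLp_mul (t : L2Sections m)).coeFn_toLp] with w h1 h2
  simp only [mulOperator, LinearMap.coe_mk, AddHom.coe_mk, h1, h2]
  simp only [RCLike.inner_apply, map_mul, Complex.conj_ofReal]
  ring

/-- The eigenvalues `λ^m_0 ≥ … ≥ λ^m_m` of `T_f^m`, counted with multiplicity. -/
def toeplitzEigenvalues (f : CP1 → ℝ) (hf : IsSmooth f) (m : ℕ) : Fin (m + 1) → ℝ :=
  (toeplitz_isSymmetric f hf m).eigenvalues (finrank_holSections m)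

/-! ### The convex sets `E_m` and their topological lim sup -/

/-- The interval `I^m_k = [k/(m+1), (k+1)/(m+1))`, as a subset of `[0,1]`. -/
def stepInterval (m : ℕ) (k : Fin (m + 1)) : Set I :=
  {x | (k : ℝ) / (m + 1) ≤ x ∧ (x : ℝ) < (k + 1) / (m + 1)}

theorem measurableSet_stepInterval (m : ℕ) (k : Fin (m + 1)) :
    MeasurableSet (stepInterval m k) :=
  (measurableSet_le measurable_const measurable_subtype_coe).inter
    (measurableSet_lt measurable_subtype_coe measurable_const)

/-- The map `p^m : ℝ^{m+1} → L²([0,1])`, `a ↦ ∑ₖ aₖ χ_{I^m_k}`. -/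
def stepMap (m : ℕ) (a : Fin (m + 1) → ℝ) : L2I :=
  ∑ k, indicatorConstLp 2 (measurableSet_stepInterval m k)
    (measure_ne_top (volume : Measure I) _) (a k)

/-- The permutohedron `co(Σ_m · x)`: the convex hull of all rearrangements of `x`. -/
def permutohedron {m : ℕ} (x : Fin (m + 1) → ℝ) : Set (Fin (m + 1) → ℝ) :=
  convexHull ℝ (range fun τ : Equiv.Perm (Fin (m + 1)) => x ∘ τ)

/-- `E_m = p^m(co(Σ_m · λ^m))`. -/
def stepSet (f : CP1 → ℝ) (hf : IsSmooth f) (m : ℕ) : Set L2I :=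
  stepMap m '' permutohedron (toeplitzEigenvalues f hf m)

/-- The topological lim sup of a sequence of subsets: the set of points all of whose neighborhoods
meet infinitely many sets of the sequence. -/
def topLimsup {X : Type*} [TopologicalSpace X] (E : ℕ → Set X) : Set X :=
  {x | ∀ V ∈ 𝓝 x, {m | (V ∩ E m).Nonempty}.Infinite}

/-- The closure of a subset of `L²([0,1])` in the weak topology. -/
def weakClosure (S : Set L2I) : Set L2I :=
  toWeakSpace ℝ L2I ⁻¹' closure (toWeakSpace ℝ L2I '' S)

end ToeplitzConvexity

end

open ToeplitzConvexity

namespace ToeplitzConvexity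

/-! ### The decreasing rearrangement and its distribution -/

section Rearrangement

variable {X : Type*} [MeasurableSpace X] {μ : Measure X} {g : X → ℝ}

/-! Everything reduces to the functions `x ↦ max (x - t) 0`: by `isMajorizedBy_iff`, g is majorized
by f exactly when the means agree and ∫ (g - t)⁺ ≤ ∫ (f - t)⁺ for every t. These conditions are
convex and norm closed in g, so Ω(f^*) is also weakly closed. It contains the orbit of f^*, whose
members have the law of f.

It contains every E_m by a Berezin–Lieb argument: each eigenvalue is the mean of f against the
probability density |e_k|² of a unit eigenvector, these densities add up to (m+1)μ, and Jensen
applies to (x - t)⁺.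

For the reverse inclusions, take g in Ω(f^*) and average g and f^* over the intervals of length
1/(m+1). Rado's theorem (`mem_permutohedron`) puts the averages of g in the permutohedron of the
averages b of f^*. Each vertex is b composed with an interval exchange, so it is as close to the
orbit of f^* as the step function of b is to f^*. This gives the closed convex hull.

For the lim sup, b must be replaced by the eigenvalue vector λ. Since λ is decreasing and majorized
by b, ⟨λ, b⟩ ≥ ⟨λ, λ⟩, so ‖b - λ‖² ≤ ‖b‖² - ‖λ‖² (`norm_stepMap_sub_sq_le`). Hence a single spectral
limit suffices: Tr(T_f²)/(m+1) → ∫ f². It holds because this trace is the integral of f times its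
Berezin transform, and the Berezin kernels are an approximate identity. The lim sup thus already
fills Ω(f^*), and the weak closure adds nothing. -/

theorem distributionFunction_eq_map (hg : AEMeasurable g μ) (t : ℝ) :
    distributionFunction μ g t = (μ.map g).real (Iio t) := by
  rw [distributionFunction, map_measureReal_apply_of_aemeasurable hg measurableSet_Iio]
  rfl

variable [IsProbabilityMeasure μ]

theorem measureReal_univ_sub_distributionFunction (hg : AEMeasurable g μ) (t : ℝ) :
    μ.real univ - distributionFunction μ g t = (μ.map g).real (Ici t) := by
  have := Measure.isProbabilityMeasure_map hg
  rw [distributionFunction_eq_map hg, ← compl_Iio, probReal_compl_eq_one_sub measurableSet_Iio,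
    probReal_univ]

/-- Continuity from above: closed half-lines [t - 1/(n+1), ∞) decrease to [t, ∞). Consequently the
infimum defining g^* is never attained, which makes the equivalence below hold with non-strict
inequalities on both sides. -/
theorem exists_lt_measureReal_Ici_lt (ν : Measure ℝ) [IsProbabilityMeasure ν] {s t : ℝ}
    (h : ν.real (Ici t) < s) : ∃ t' < t, ν.real (Ici t') < s := by
  have hU : ⋂ n : ℕ, Ici (t - 1 / ((n : ℝ) + 1)) = Ici t := by
    ext x
    simp only [mem_iInter, mem_Ici]
    refine ⟨fun hx => ?_, fun hx n => ?_⟩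
    · by_contra! hlt
      obtain ⟨n, hn⟩ := exists_nat_one_div_lt (sub_pos.2 hlt)
      have := hx n
      linarith
    · have : 0 ≤ 1 / ((n : ℝ) + 1) := by positivity
      linarith
  have hT : Tendsto (fun n : ℕ => ν (Ici (t - 1 / ((n : ℝ) + 1)))) atTop (𝓝 (ν (Ici t))) := by
    rw [← hU]
    refine tendsto_measure_iInter_atTop (fun n => measurableSet_Ici.nullMeasurableSet) ?_
      ⟨0, measure_ne_top _ _⟩
    intro m n hmn
    refine Ici_subset_Ici.2 ?_
    have : 1 / ((n : ℝ) + 1) ≤ 1 / ((m : ℝ) + 1) := by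
      apply one_div_le_one_div_of_le (by positivity)
      gcongr
    linarith
  have hT' : Tendsto (fun n : ℕ => ν.real (Ici (t - 1 / ((n : ℝ) + 1)))) atTop
      (𝓝 (ν.real (Ici t))) := (ENNReal.tendsto_toReal (measure_ne_top _ _)).comp hT
  obtain ⟨n, hn⟩ := (hT'.eventually_lt_const h).exists
  exact ⟨_, by have : 0 < 1 / ((n : ℝ) + 1) := by positivity
               linarith, hn⟩

/-- The Galois connection between `g^*` and the tail of the distribution of `g`. -/
theorem le_decreasingRearrangement_iff (hg : AEMeasurable g μ) {s : ℝ} (hs : s ∈ Ioo (0 : ℝ) 1)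
    (t : ℝ) : t ≤ decreasingRearrangement μ g s ↔ s ≤ (μ.map g).real (Ici t) := by
  have := Measure.isProbabilityMeasure_map hg
  simp only [decreasingRearrangement, measureReal_univ_sub_distributionFunction hg]
  set ν := μ.map g
  -- The bound s < 1 makes the set of levels bounded below (`hb` with `key`), and 0 < s makes it
  -- nonempty (`hn`); otherwise `sInf` would return its default value 0.
  have hb : ∃ t, s ≤ ν.real (Ici t) := by
    obtain ⟨t, ht⟩ := ((ProbabilityTheory.tendsto_cdf_atBot ν).eventually_lt_const
      (sub_pos.2 hs.2)).exists
    rw [ProbabilityTheory.cdf_eq_real] at ht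
    refine ⟨t, ?_⟩
    have h1 : ν.real (Ici t) = 1 - ν.real (Iio t) := by
      rw [← compl_Iio, probReal_compl_eq_one_sub measurableSet_Iio]
    have h2 : ν.real (Iio t) ≤ ν.real (Iic t) := measureReal_mono Iio_subset_Iic_self
    linarith
  have hn : ∃ t, ν.real (Ici t) < s := by
    obtain ⟨t, ht⟩ := ((ProbabilityTheory.tendsto_cdf_atTop ν).eventually_const_lt
      (sub_lt_self 1 hs.1)).exists
    rw [ProbabilityTheory.cdf_eq_real] at ht
    refine ⟨t + 1, ?_⟩
    have h1 : ν.real (Ioi t) = 1 - ν.real (Iic t) := by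
      rw [← compl_Iic, probReal_compl_eq_one_sub measurableSet_Iic]
    have h2 : ν.real (Ici (t + 1)) ≤ ν.real (Ioi t) :=
      measureReal_mono (Ici_subset_Ioi.2 (lt_add_one t))
    linarith
  have key : ∀ t, s ≤ ν.real (Ici t) → t ∈ lowerBounds {t | ν.real (Ici t) < s} := by
    intro t ht u hu
    by_contra! hlt
    exact absurd (hu : ν.real (Ici u) < s) (not_lt.2 (ht.trans
      (measureReal_mono (Ici_subset_Ici.2 hlt.le))))
  constructor
  · intro h
    by_contra! hlt
    obtain ⟨t', ht', hlt'⟩ := exists_lt_measureReal_Ici_lt ν hlt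
    obtain ⟨b, hb⟩ := hb
    have := csInf_le ⟨b, key b hb⟩ (show t' ∈ {t | ν.real (Ici t) < s} from hlt')
    linarith
  · intro h
    exact le_csInf hn (key t h)

theorem antitoneOn_decreasingRearrangement (hg : AEMeasurable g μ) :
    AntitoneOn (decreasingRearrangement μ g) (Ioo 0 1) := by
  intro a ha b hb hab
  rw [le_decreasingRearrangement_iff hg ha]
  exact hab.trans ((le_decreasingRearrangement_iff hg hb _).1 le_rfl)

instance isProbabilityMeasure_volume_Ioo :
    IsProbabilityMeasure ((volume : Measure ℝ).restrict (Ioo 0 1)) := ⟨by simp⟩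

/-- By the Galois connection, g^* ≥ t holds on (0, 1) exactly up to the mass of {g ≥ t}, and closed
half-lines determine a law. -/
theorem identDistrib_decreasingRearrangement (hg : AEMeasurable g μ) :
    ProbabilityTheory.IdentDistrib (decreasingRearrangement μ g) g
      ((volume : Measure ℝ).restrict (Ioo 0 1)) μ := by
  have hm := aemeasurable_restrict_of_antitoneOn (μ := (volume : Measure ℝ))
    measurableSet_Ioo (antitoneOn_decreasingRearrangement hg)
  have := Measure.isProbabilityMeasure_map hg
  have := Measure.isProbabilityMeasure_map hm
  refine ⟨hm, hg, Measure.ext_of_Ici _ _ fun t => ?_⟩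
  have h1 : ((volume : Measure ℝ).restrict (Ioo 0 1)) (decreasingRearrangement μ g ⁻¹' Ici t) =
      volume (Ioo 0 1 ∩ Iic ((μ.map g).real (Ici t))) := by
    rw [Measure.restrict_apply' measurableSet_Ioo]
    congr 1
    ext s
    simp only [mem_inter_iff, mem_preimage, mem_Ici, mem_Iic]
    rw [and_comm]
    exact and_congr_right fun hs => le_decreasingRearrangement_iff hg hs t
  rw [Measure.map_apply_of_aemeasurable hm measurableSet_Ici, h1]
  have hle : (μ.map g).real (Ici t) ≤ 1 := measureReal_le_one
  refine Eq.trans ?_ (ofReal_measureReal (μ := μ.map g) (s := Ici t))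
  generalize (μ.map g).real (Ici t) = c at hle
  refine le_antisymm ?_ ?_
  · refine (measure_mono (t := Ioc 0 c) fun x hx => ⟨hx.1.1, hx.2⟩).trans ?_
    simp
  · refine le_trans ?_ (measure_mono (s := Ioo 0 c)
      fun x hx => ⟨⟨hx.1, hx.2.trans_le hle⟩, hx.2.le⟩)
    simp

theorem integrableOn_decreasingRearrangement (hg : Integrable g μ) :
    IntegrableOn (decreasingRearrangement μ g) (Ioo 0 1) :=
  (identDistrib_decreasingRearrangement hg.1.aemeasurable).integrable_iff.2 hg

theorem intervalIntegrable_decreasingRearrangement (hg : Integrable g μ) {a b : ℝ}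
    (ha : 0 ≤ a) (hab : a ≤ b) (hb : b ≤ 1) :
    IntervalIntegrable (decreasingRearrangement μ g) volume a b := by
  rw [intervalIntegrable_iff_integrableOn_Ioo_of_le hab]
  exact (integrableOn_decreasingRearrangement hg).mono_set (Ioo_subset_Ioo ha hb)

theorem integral_decreasingRearrangement (hg : Integrable g μ) :
    ∫ z in (0 : ℝ)..1, decreasingRearrangement μ g z = ∫ x, g x ∂μ := by
  rw [intervalIntegral.integral_of_le zero_le_one, integral_Ioc_eq_integral_Ioo]
  exact (identDistrib_decreasingRearrangement hg.1.aemeasurable).integral_eq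

theorem _root_.MeasureTheory.Integrable.sub_const_pos_part {X : Type*} [MeasurableSpace X]
    {μ : Measure X} [IsFiniteMeasure μ] {g : X → ℝ} (hg : Integrable g μ) (t : ℝ) :
    Integrable (fun x => max (g x - t) 0) μ :=
  (hg.sub (integrable_const t)).pos_part

theorem integral_decreasingRearrangement_pos_part (hg : Integrable g μ) (t : ℝ) :
    ∫ z in (0 : ℝ)..1, max (decreasingRearrangement μ g z - t) 0 =
      ∫ x, max (g x - t) 0 ∂μ := by
  rw [intervalIntegral.integral_of_le zero_le_one, integral_Ioc_eq_integral_Ioo]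
  exact ((identDistrib_decreasingRearrangement hg.1.aemeasurable).comp
    (u := fun y : ℝ => max (y - t) 0) (by fun_prop)).integral_eq

theorem intervalIntegrable_decreasingRearrangement_pos_part (hg : Integrable g μ) (t : ℝ) {a b : ℝ}
    (ha : 0 ≤ a) (hab : a ≤ b) (hb : b ≤ 1) :
    IntervalIntegrable (fun z => max (decreasingRearrangement μ g z - t) 0) volume a b := by
  rw [intervalIntegrable_iff_integrableOn_Ioo_of_le hab]
  exact ((integrableOn_decreasingRearrangement hg).mono_set
    (Ioo_subset_Ioo ha hb)).integrable.sub_const_pos_part t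

/-- Integrate g^* ≤ t + (g^* - t)⁺ over (0, s) and enlarge the positive part to (0, 1). With the
next lemmas this is a duality: for 0 < s < 1 the partial integral of g^* is the minimum over t of
the right-hand side, attained at t = g^*(s). -/
theorem integral_decreasingRearrangement_le (hg : Integrable g μ) {s : ℝ} (hs : s ∈ Icc (0 : ℝ) 1)
    (t : ℝ) :
    ∫ z in (0 : ℝ)..s, decreasingRearrangement μ g z ≤ s * t + ∫ x, max (g x - t) 0 ∂μ := by
  rw [← integral_decreasingRearrangement_pos_part hg,
    ← intervalIntegral.integral_add_adjacent_intervals (b := s)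
      (intervalIntegrable_decreasingRearrangement_pos_part hg t le_rfl hs.1 hs.2)
      (intervalIntegrable_decreasingRearrangement_pos_part hg t hs.1 hs.2 le_rfl)]
  have h1 : 0 ≤ ∫ z in s..1, max (decreasingRearrangement μ g z - t) 0 :=
    intervalIntegral.integral_nonneg hs.2 fun _ _ => le_max_right _ _
  have h2 : ∫ z in (0 : ℝ)..s, decreasingRearrangement μ g z ≤
      ∫ z in (0 : ℝ)..s, (t + max (decreasingRearrangement μ g z - t) 0) :=
    intervalIntegral.integral_mono_on hs.1
      (intervalIntegrable_decreasingRearrangement hg le_rfl hs.1 hs.2)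
      (intervalIntegrable_const.add
        (intervalIntegrable_decreasingRearrangement_pos_part hg t le_rfl hs.1 hs.2))
      fun z _ => by linarith [le_max_left (decreasingRearrangement μ g z - t) 0]
  rw [intervalIntegral.integral_add intervalIntegrable_const
    (intervalIntegrable_decreasingRearrangement_pos_part hg t le_rfl hs.1 hs.2),
    intervalIntegral.integral_const] at h2
  simp only [sub_zero, smul_eq_mul] at h2
  linarith

theorem integral_decreasingRearrangement_eq (hg : Integrable g μ) {s : ℝ} (hs : s ∈ Icc (0 : ℝ) 1)
    {t : ℝ} (h1 : ∀ z ∈ Ioo 0 s, t ≤ decreasingRearrangement μ g z)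
    (h2 : ∀ z ∈ Ioo s 1, decreasingRearrangement μ g z ≤ t) :
    ∫ z in (0 : ℝ)..s, decreasingRearrangement μ g z = s * t + ∫ x, max (g x - t) 0 ∂μ := by
  rw [← integral_decreasingRearrangement_pos_part hg,
    ← intervalIntegral.integral_add_adjacent_intervals (b := s)
      (intervalIntegrable_decreasingRearrangement_pos_part hg t le_rfl hs.1 hs.2)
      (intervalIntegrable_decreasingRearrangement_pos_part hg t hs.1 hs.2 le_rfl)]
  have e1 : ∫ z in s..1, max (decreasingRearrangement μ g z - t) 0 = 0 := by
    rw [intervalIntegral.integral_of_le hs.2, integral_Ioc_eq_integral_Ioo]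
    refine setIntegral_eq_zero_of_forall_eq_zero fun z hz => ?_
    exact max_eq_right (sub_nonpos.2 (h2 z hz))
  have e2 : ∫ z in (0 : ℝ)..s, max (decreasingRearrangement μ g z - t) 0 =
      ∫ z in (0 : ℝ)..s, (decreasingRearrangement μ g z - t) := by
    rw [intervalIntegral.integral_of_le hs.1, intervalIntegral.integral_of_le hs.1,
      integral_Ioc_eq_integral_Ioo, integral_Ioc_eq_integral_Ioo]
    refine setIntegral_congr_fun measurableSet_Ioo fun z hz => ?_
    exact max_eq_left (sub_nonneg.2 (h1 z hz))
  rw [e1, e2, intervalIntegral.integral_sub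
    (intervalIntegrable_decreasingRearrangement hg le_rfl hs.1 hs.2) intervalIntegrable_const,
    intervalIntegral.integral_const]
  simp only [sub_zero, smul_eq_mul]
  ring

theorem integral_decreasingRearrangement_eq_self (hg : Integrable g μ) {s : ℝ}
    (hs : s ∈ Ioo (0 : ℝ) 1) :
    ∫ z in (0 : ℝ)..s, decreasingRearrangement μ g z =
      s * decreasingRearrangement μ g s + ∫ x, max (g x - decreasingRearrangement μ g s) 0 ∂μ := by
  have ha := antitoneOn_decreasingRearrangement hg.1.aemeasurable
  exact integral_decreasingRearrangement_eq hg ⟨hs.1.le, hs.2.le⟩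
    (fun z hz => ha ⟨hz.1, hz.2.trans hs.2⟩ hs hz.2.le)
    (fun z hz => ha hs ⟨hs.1.trans hz.1, hz.2⟩ hz.1.le)

/-- The other direction of the duality: s is the mass of {g ≥ t}, the place where g^* crosses the
level t. -/
theorem exists_integral_decreasingRearrangement_eq (hg : Integrable g μ) (t : ℝ) :
    ∃ s ∈ Icc (0 : ℝ) 1, ∫ z in (0 : ℝ)..s, decreasingRearrangement μ g z =
      s * t + ∫ x, max (g x - t) 0 ∂μ := by
  have hg' := hg.1.aemeasurable
  have := Measure.isProbabilityMeasure_map hg'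
  have hs : (μ.map g).real (Ici t) ∈ Icc (0 : ℝ) 1 := ⟨measureReal_nonneg, measureReal_le_one⟩
  refine ⟨_, hs, integral_decreasingRearrangement_eq hg hs (fun z hz => ?_) (fun z hz => ?_)⟩
  · exact (le_decreasingRearrangement_iff hg' ⟨hz.1, hz.2.trans_le hs.2⟩ t).2 hz.2.le
  · by_contra! hlt
    have := (le_decreasingRearrangement_iff hg' ⟨hs.1.trans_lt hz.1, hz.2⟩ t).1 hlt.le
    linarith [hz.1]

/-- Majorization in terms of the convex functions `x ↦ (x - t)⁺`. -/
theorem isMajorizedBy_iff {h : X → ℝ} (hg : Integrable g μ) (hh : Integrable h μ) :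
    IsMajorizedBy μ g h ↔
      (∀ t, ∫ x, max (g x - t) 0 ∂μ ≤ ∫ x, max (h x - t) 0 ∂μ) ∧ ∫ x, g x ∂μ = ∫ x, h x ∂μ := by
  rw [IsMajorizedBy, integral_decreasingRearrangement hg, integral_decreasingRearrangement hh]
  refine and_congr_left fun heq => ⟨fun H t => ?_, fun H s hs => ?_⟩
  -- For a given t, use the s optimal for g; conversely, for a given s, use t = h^*(s), optimal for
  -- h. The case s = 1 comes from equality of the means, as the majorization inequality covers only
  -- s < 1.
  · obtain ⟨s, hs, he⟩ := exists_integral_decreasingRearrangement_eq hg t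
    have h1 := integral_decreasingRearrangement_le hh hs t
    have h2 : ∫ z in (0 : ℝ)..s, decreasingRearrangement μ g z ≤
        ∫ z in (0 : ℝ)..s, decreasingRearrangement μ h z := by
      rcases hs.2.eq_or_lt with rfl | hlt
      · rw [integral_decreasingRearrangement hg, integral_decreasingRearrangement hh, heq]
      · exact H s ⟨hs.1, hlt⟩
    linarith
  · rcases hs.1.eq_or_lt with rfl | hlt
    · simp
    · rw [integral_decreasingRearrangement_eq_self hh ⟨hlt, hs.2⟩]
      exact (integral_decreasingRearrangement_le hg ⟨hs.1, hs.2.le⟩ _).trans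
        (add_le_add_right (H _) _)

end Rearrangement

section

/-! ### The set of functions majorized by `f` -/

theorem mk_eq_affineChart {v : Fin 2 → ℂ} (hv : v ≠ 0) (h : v 0 ≠ 0) :
    (Projectivization.mk ℂ v hv : CP1) = affineChart (v 1 / v 0) := by
  refine (Projectivization.mk_eq_mk_iff' _ _ _ _ _).2 ⟨v 0, ?_⟩
  ext i
  fin_cases i
  · simp
  · simp [mul_div_cancel₀, h]

theorem mk_eq_affineChartInfty {v : Fin 2 → ℂ} (hv : v ≠ 0) (h : v 1 ≠ 0) :
    (Projectivization.mk ℂ v hv : CP1) = affineChartInfty (v 0 / v 1) := by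
  refine (Projectivization.mk_eq_mk_iff' _ _ _ _ _).2 ⟨v 1, ?_⟩
  ext i
  fin_cases i
  · simp [mul_div_cancel₀, h]
  · simp

variable {f : CP1 → ℝ}

theorem continuous_coordinate (i : Fin 2) :
    Continuous fun u : {v : Fin 2 → ℂ // v ≠ 0} => u.1 i :=
  (continuous_apply i).comp continuous_subtype_val

theorem IsSmooth.continuous (hf : IsSmooth f) : Continuous f := by
  refine continuous_coinduced_dom.2 (continuous_iff_continuousAt.2 fun v => ?_)
  by_cases h0 : v.1 0 = 0
  · have h1 : v.1 1 ≠ 0 := by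
      intro h1
      refine v.2 (funext fun i => ?_)
      fin_cases i
      · exact h0
      · exact h1
    have hc : ContinuousAt (fun u : {v : Fin 2 → ℂ // v ≠ 0} => u.1 0 / u.1 1) v :=
      (continuous_coordinate 0).continuousAt.div (continuous_coordinate 1).continuousAt h1
    refine (ContinuousAt.comp (f := fun u : {v : Fin 2 → ℂ // v ≠ 0} => u.1 0 / u.1 1)
      (hf.2.continuous.continuousAt) hc).congr ?_
    have ho : ∀ᶠ u : {v : Fin 2 → ℂ // v ≠ 0} in 𝓝 v, u.1 1 ≠ 0 :=
      (continuous_coordinate 1).continuousAt.eventually_ne h1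
    filter_upwards [ho] with u hu
    exact congrArg f (mk_eq_affineChartInfty u.2 hu).symm
  · have hc : ContinuousAt (fun u : {v : Fin 2 → ℂ // v ≠ 0} => u.1 1 / u.1 0) v :=
      (continuous_coordinate 1).continuousAt.div (continuous_coordinate 0).continuousAt h0
    refine (ContinuousAt.comp (f := fun u : {v : Fin 2 → ℂ // v ≠ 0} => u.1 1 / u.1 0)
      (hf.1.continuous.continuousAt) hc).congr ?_
    have ho : ∀ᶠ u : {v : Fin 2 → ℂ // v ≠ 0} in 𝓝 v, u.1 0 ≠ 0 :=
      (continuous_coordinate 0).continuousAt.eventually_ne h0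
    filter_upwards [ho] with u hu
    exact congrArg f (mk_eq_affineChart u.2 hu).symm

theorem IsSmooth.integrable (hf : IsSmooth f) : Integrable f areaMeasure := by
  obtain ⟨C, -, hC⟩ := hf.bounded
  exact Integrable.of_bound hf.continuous.measurable.aestronglyMeasurable C
    (Eventually.of_forall hC)

theorem map_coe_volume_unitInterval :
    (volume : Measure I).map ((↑) : I → ℝ) = (volume : Measure ℝ).restrict (Ioo 0 1) := by
  rw [unitInterval.measurePreserving_coe.map_eq]
  exact restrict_Ioo_eq_restrict_Icc.symm

theorem IsSmooth.identDistrib_rearr (hf : IsSmooth f) :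
    ProbabilityTheory.IdentDistrib (rearr f) f (volume : Measure I) areaMeasure := by
  have h := identDistrib_decreasingRearrangement (μ := areaMeasure)
    hf.continuous.measurable.aemeasurable
  refine ⟨hf.memLp_rearr.1.aemeasurable, h.aemeasurable_snd, ?_⟩
  rw [← h.map_eq, ← map_coe_volume_unitInterval, AEMeasurable.map_map_of_aemeasurable _
    measurable_subtype_coe.aemeasurable]
  · rfl
  · rw [map_coe_volume_unitInterval]
    exact h.aemeasurable_fst

/-- The criterion used from here on: f^* is equidistributed with f, so the right-hand sides become
integrals over the sphere. -/
theorem mem_majorizedSet_iff (hf : IsSmooth f) (g : L2I) :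
    g ∈ majorizedSet f ↔ (∀ t, ∫ x, max (g x - t) 0 ≤ ∫ p, max (f p - t) 0 ∂areaMeasure) ∧
      ∫ x, g x = ∫ p, f p ∂areaMeasure := by
  rw [majorizedSet, mem_ofPred_eq, isMajorizedBy_iff ((Lp.memLp g).integrable (by norm_num))
    (hf.memLp_rearr.integrable (by norm_num)), hf.identDistrib_rearr.integral_eq]
  have : ∀ t, ∫ x, max (rearr f x - t) 0 = ∫ p, max (f p - t) 0 ∂areaMeasure := fun t =>
    (hf.identDistrib_rearr.comp (u := fun y : ℝ => max (y - t) 0) (by fun_prop)).integral_eq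
  simp only [this]

theorem integrable_coeFn (g : L2I) : Integrable g :=
  (Lp.memLp g).integrable (by norm_num)

theorem integral_abs_le_norm (g : L2I) : ∫ x, |g x| ≤ ‖g‖ := by
  have h : eLpNorm g 1 volume ≤ eLpNorm g 2 volume :=
    eLpNorm_le_eLpNorm_of_exponent_le (by norm_num) (Lp.aestronglyMeasurable g)
  have h2 := ENNReal.toReal_mono (Lp.eLpNorm_ne_top g) h
  rw [← Lp.norm_def] at h2
  refine le_trans (le_of_eq ?_) h2
  rw [eLpNorm_one_eq_lintegral_enorm, ← integral_norm_eq_lintegral_enorm (Lp.aestronglyMeasurable g)]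
  rfl

/-- On a probability space the L¹ norm is at most the L² norm, so the functional is itself
1-Lipschitz. -/
theorem continuous_integral_comp_of_dist_le {u : ℝ → ℝ} (hu : LipschitzWith 1 u) :
    Continuous fun g : L2I => ∫ x, u (g x) := by
  have hint : ∀ g : L2I, Integrable fun x => u (g x) := by
    intro g
    have h1 : Integrable fun x => |g x| + |u 0| := (integrable_coeFn g).abs.add
      (integrable_const _)
    refine h1.mono' (hu.continuous.comp_aestronglyMeasurable (Lp.aestronglyMeasurable g))
      (Eventually.of_forall fun x => ?_)
    have h2 := hu.dist_le_mul (g x) 0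
    rw [Real.dist_eq, Real.dist_eq, NNReal.coe_one, one_mul, sub_zero] at h2
    have h3 := abs_sub_abs_le_abs_sub (u (g x)) (u 0)
    rw [Real.norm_eq_abs]
    linarith
  refine (LipschitzWith.of_dist_le_mul (K := 1) fun g h => ?_).continuous
  rw [Real.dist_eq, NNReal.coe_one, one_mul, dist_eq_norm, ← integral_sub (hint g) (hint h)]
  refine (abs_integral_le_integral_abs).trans (le_trans ?_ (integral_abs_le_norm (g - h)))
  refine integral_mono_ae ((hint g).sub (hint h)).abs (integrable_coeFn (g - h)).abs ?_
  filter_upwards [Lp.coeFn_sub g h] with x hx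
  rw [hx]
  simpa [Real.dist_eq] using hu.dist_le_mul (g x) (h x)

theorem continuous_integral_pos_part (t : ℝ) :
    Continuous fun g : L2I => ∫ x, max (g x - t) 0 := by
  refine continuous_integral_comp_of_dist_le (u := fun y => max (y - t) 0)
    (LipschitzWith.of_dist_le_mul fun x y => ?_)
  rw [Real.dist_eq, Real.dist_eq, NNReal.coe_one, one_mul]
  refine (abs_max_sub_max_le_abs _ _ _).trans (le_of_eq ?_)
  congr 1
  ring

theorem isClosed_majorizedSet (hf : IsSmooth f) : IsClosed (majorizedSet f) := by
  have : majorizedSet f = (⋂ t, {g : L2I | ∫ x, max (g x - t) 0 ≤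
      ∫ p, max (f p - t) 0 ∂areaMeasure}) ∩ {g : L2I | ∫ x, g x = ∫ p, f p ∂areaMeasure} := by
    ext g
    simp [mem_majorizedSet_iff hf]
  rw [this]
  exact (isClosed_iInter fun t => isClosed_le (continuous_integral_pos_part t)
    continuous_const).inter
    (isClosed_eq (continuous_integral_comp_of_dist_le LipschitzWith.id) continuous_const)

theorem convex_majorizedSet (hf : IsSmooth f) : Convex ℝ (majorizedSet f) := by
  intro g hg h hh a b ha hb hab
  rw [mem_majorizedSet_iff hf] at hg hh ⊢
  have hc : ((a • g + b • h : L2I) : I → ℝ) =ᵐ[volume] fun x => a * g x + b * h x := by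
    filter_upwards [Lp.coeFn_add (a • g) (b • h), Lp.coeFn_smul a g, Lp.coeFn_smul b h]
      with x h1 h2 h3
    rw [h1, Pi.add_apply, h2, h3]
    rfl
  have hig := integrable_coeFn g
  have hih := integrable_coeFn h
  constructor
  · intro t
    calc ∫ x, max ((a • g + b • h : L2I) x - t) 0
        ≤ ∫ x, (a * max (g x - t) 0 + b * max (h x - t) 0) := by
          refine integral_mono_ae ((integrable_coeFn _).sub_const_pos_part t)
            (((hig.sub_const_pos_part t).const_mul a).add
              ((hih.sub_const_pos_part t).const_mul b)) ?_
          filter_upwards [hc] with x hx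
          rw [hx]
          refine max_le ?_ (by positivity)
          have h1 := mul_le_mul_of_nonneg_left (le_max_left (g x - t) 0) ha
          have h2 := mul_le_mul_of_nonneg_left (le_max_left (h x - t) 0) hb
          have h3 : t = a * t + b * t := by rw [← add_mul, hab, one_mul]
          linarith
      _ = a * (∫ x, max (g x - t) 0) + b * ∫ x, max (h x - t) 0 := by
          rw [integral_add ((hig.sub_const_pos_part t).const_mul a)
            ((hih.sub_const_pos_part t).const_mul b), integral_const_mul, integral_const_mul]
      _ ≤ a * (∫ p, max (f p - t) 0 ∂areaMeasure) + b * ∫ p, max (f p - t) 0 ∂areaMeasure := by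
          gcongr
          · exact hg.1 t
          · exact hh.1 t
      _ = ∫ p, max (f p - t) 0 ∂areaMeasure := by rw [← add_mul, hab, one_mul]
  · rw [integral_congr_ae hc, integral_add (hig.const_mul a) (hih.const_mul b),
      integral_const_mul, integral_const_mul, hg.2, hh.2, ← add_mul, hab, one_mul]

/-! ### Weak closure, topological lim sup and the orbit -/

/-- Mazur: norm and weak closures of a convex set coincide. -/
theorem weakClosure_subset {S K : Set L2I} (hK : Convex ℝ K) (hK' : IsClosed K) (h : S ⊆ K) :
    weakClosure S ⊆ K := by
  intro g hg
  have h1 : toWeakSpace ℝ L2I g ∈ closure (toWeakSpace ℝ L2I '' K) :=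
    closure_mono (image_mono h) hg
  rw [← hK.toWeakSpace_closure ℝ, hK'.closure_eq] at h1
  exact (toWeakSpace ℝ L2I).injective.mem_set_image.1 h1

theorem subset_weakClosure (S : Set L2I) : S ⊆ weakClosure S := fun g hg =>
  show toWeakSpace ℝ L2I g ∈ closure (toWeakSpace ℝ L2I '' S) from
    subset_closure (mem_image_of_mem _ hg)

theorem topLimsup_subset {E : ℕ → Set L2I} {K : Set L2I} (hK : IsClosed K) (h : ∀ m, E m ⊆ K) :
    topLimsup E ⊆ K := by
  intro x hx
  by_contra hxK
  obtain ⟨m, y, hy, hyE⟩ := (hx Kᶜ (hK.isOpen_compl.mem_nhds hxK)).nonempty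
  exact hy (h m hyE)

theorem mem_topLimsup_of_tendsto {X : Type*} [TopologicalSpace X] {E : ℕ → Set X} {x : X}
    {u : ℕ → X} (hu : ∀ m, u m ∈ E m) (h : Tendsto u atTop (𝓝 x)) : x ∈ topLimsup E := by
  intro V hV
  rw [← Nat.frequently_atTop_iff_infinite]
  exact ((h.eventually_mem hV).mono fun m hm => ⟨u m, hm, hu m⟩).frequently

theorem smeasOrbit_subset_majorizedSet (hf : IsSmooth f) : smeasOrbit f hf ⊆ majorizedSet f := by
  rintro g ⟨φ, hφ, rfl⟩
  rw [mem_majorizedSet_iff hf]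
  have h1 : (Lp.compMeasurePreserving φ hφ (rearrL2 f hf) : I → ℝ) =ᵐ[volume]
      rearr f ∘ φ :=
    (Lp.coeFn_compMeasurePreserving (rearrL2 f hf) hφ).trans
      (hφ.quasiMeasurePreserving.ae_eq_comp hf.memLp_rearr.coeFn_toLp)
  have h2 : ProbabilityTheory.IdentDistrib
      (Lp.compMeasurePreserving φ hφ (rearrL2 f hf) : I → ℝ) f volume areaMeasure := by
    refine (ProbabilityTheory.IdentDistrib.of_ae_eq
      (Lp.aestronglyMeasurable _).aemeasurable h1).trans ?_
    have hm := hf.memLp_rearr.1.aemeasurable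
    have hm' : AEMeasurable (rearr f) ((volume : Measure I).map φ) := by rwa [hφ.map_eq]
    refine ProbabilityTheory.IdentDistrib.trans ⟨hm'.comp_measurable hφ.measurable, hm, ?_⟩
      hf.identDistrib_rearr
    rw [← AEMeasurable.map_map_of_aemeasurable hm' hφ.aemeasurable, hφ.map_eq]
  exact ⟨fun t => (h2.comp (u := fun y : ℝ => max (y - t) 0) (by fun_prop)).integral_eq.le,
    h2.integral_eq⟩

end

section

/-! ### Rado's theorem on the permutohedron -/

theorem sum_filter_val_lt (u : ℕ → ℝ) {n k : ℕ} (hk : k ≤ n) :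
    ∑ j ∈ Finset.univ.filter (fun j : Fin n => j.val < k), u j = ∑ i ∈ Finset.range k, u i := by
  rw [Finset.sum_filter, Fin.sum_univ_eq_sum_range (fun i => if i < k then u i else 0) n,
    ← Finset.sum_filter]
  congr 1
  ext i
  simp only [Finset.mem_filter, Finset.mem_range]
  omega

/-- The difference of the two sides is the sum over k < n of (c_k - c_{k+1})(d_0 + … + d_k), with
nonnegative terms; c itself may have any sign. -/
theorem mul_sum_range_le_sum_mul {c d : ℕ → ℝ} (n : ℕ) (hc : ∀ k < n, c (k + 1) ≤ c k)
    (hd : ∀ k ≤ n, 0 ≤ ∑ i ∈ Finset.range k, d i) :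
    c n * ∑ i ∈ Finset.range (n + 1), d i ≤ ∑ i ∈ Finset.range (n + 1), c i * d i := by
  induction n with
  | zero => simp
  | succ n ih =>
    have h1 := ih (fun k hk => hc k (by omega)) (fun k hk => hd k (by omega))
    have h2 := mul_le_mul_of_nonneg_right (hc n (by omega)) (hd (n + 1) le_rfl)
    rw [Finset.sum_range_succ _ (n + 1), Finset.sum_range_succ (fun i => c i * d i) (n + 1)]
    linarith

/-- Abel summation: an antitone weight is monotone for majorization. -/
theorem sum_mul_le_sum_mul_of_antitone {m : ℕ} {a b c : Fin (m + 1) → ℝ} (hc : Antitone c)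
    (h : ∀ k ≤ m, ∑ j ∈ Finset.univ.filter (fun j : Fin (m + 1) => j.val < k), a j ≤
      ∑ j ∈ Finset.univ.filter (fun j : Fin (m + 1) => j.val < k), b j)
    (heq : ∑ j, a j = ∑ j, b j) : ∑ j, c j * a j ≤ ∑ j, c j * b j := by
  -- `Fin.ofNat` wraps around modulo m+1, which is harmless since only indices up to m enter.
  let c' : ℕ → ℝ := fun i => c (Fin.ofNat (m + 1) i)
  let d : ℕ → ℝ := fun i => b (Fin.ofNat (m + 1) i) - a (Fin.ofNat (m + 1) i)
  have hof : ∀ j : Fin (m + 1), Fin.ofNat (m + 1) j.val = j := fun j => by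
    ext; simp
  have key := mul_sum_range_le_sum_mul (c := c') (d := d) m
    (fun k hk => hc (by
      rw [Fin.le_def, Fin.val_ofNat, Fin.val_ofNat, Nat.mod_eq_of_lt (by omega),
        Nat.mod_eq_of_lt (by omega)]
      omega))
    (fun k hk => by
      rw [← sum_filter_val_lt d (n := m + 1) (by omega)]
      simp only [d, hof, Finset.sum_sub_distrib]
      linarith [h k hk])
  rw [← Fin.sum_univ_eq_sum_range, ← Fin.sum_univ_eq_sum_range (fun i => c' i * d i)] at key
  simp only [c', d, hof, Finset.sum_sub_distrib, mul_sub] at key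
  rw [heq] at key
  linarith

/-- If a were outside, Hahn–Banach would give a linear form larger at a than at every permutation of
b. Sort its coefficients decreasingly by τ: Abel summation then bounds its value at a by its value
at b ∘ τ⁻¹, a contradiction. -/
theorem mem_permutohedron {m : ℕ} {a b : Fin (m + 1) → ℝ}
    (h : ∀ τ : Equiv.Perm (Fin (m + 1)), ∀ k ≤ m,
      ∑ j ∈ Finset.univ.filter (fun j : Fin (m + 1) => j.val < k), a (τ j) ≤
        ∑ j ∈ Finset.univ.filter (fun j : Fin (m + 1) => j.val < k), b j)
    (heq : ∑ j, a j = ∑ j, b j) : a ∈ permutohedron b := by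
  by_contra hmem
  obtain ⟨φ, u, h1, h2⟩ := geometric_hahn_banach_closed_point (convex_convexHull ℝ _)
    ((finite_range fun τ : Equiv.Perm (Fin (m + 1)) => b ∘ τ).isClosed_convexHull ℝ) hmem
  set c : Fin (m + 1) → ℝ := fun i => φ fun j => if i = j then 1 else 0
  have hφ : ∀ x, φ x = ∑ i, c i * x i := fun x => by
    have := LinearMap.pi_apply_eq_sum_univ (φ : (Fin (m + 1) → ℝ) →ₗ[ℝ] ℝ) x
    simp only [ContinuousLinearMap.coe_coe, smul_eq_mul] at this
    rw [this]
    exact Finset.sum_congr rfl fun i _ => mul_comm _ _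
  set τ := Tuple.sort fun i => -c i
  have hτ : Antitone (c ∘ τ) := fun i j hij => by
    have := Tuple.monotone_sort (fun i => -c i) hij
    simp only [Function.comp_apply] at this ⊢
    linarith
  have h3 := sum_mul_le_sum_mul_of_antitone hτ (a := a ∘ τ) (b := b) (h τ)
    (by rw [← heq]; exact Equiv.sum_comp τ a)
  have h4 : φ a = ∑ j, (c ∘ τ) j * (a ∘ τ) j := by
    rw [hφ]
    exact (Equiv.sum_comp τ fun i => c i * a i).symm
  have h5 : φ (b ∘ τ.symm) = ∑ j, (c ∘ τ) j * b j := by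
    rw [hφ, ← Equiv.sum_comp τ]
    simp
  have h6 := h1 (b ∘ τ.symm) (subset_convexHull ℝ _ ⟨τ.symm, rfl⟩)
  linarith

/-! ### Step functions on `[0,1]` -/

/-- The index `k` such that `x ∈ [k/(m+1), (k+1)/(m+1))`, and `m` for `x = 1`. -/
noncomputable def stepIndex (m : ℕ) (x : I) : Fin (m + 1) :=
  ⟨min ⌊((m : ℝ) + 1) * x⌋₊ m, Nat.lt_succ_of_le (min_le_right _ _)⟩

variable {m : ℕ}

theorem stepIndex_div_le (x : I) : (stepIndex m x : ℝ) / (m + 1) ≤ x := by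
  rw [div_le_iff₀ (by positivity), mul_comm]
  have h1 : (stepIndex m x : ℝ) ≤ ⌊((m : ℝ) + 1) * x⌋₊ :=
    Nat.cast_le.2 (min_le_left _ _)
  exact h1.trans (Nat.floor_le (mul_nonneg (by positivity) x.2.1))

theorem le_stepIndex_add_one_div (x : I) : (x : ℝ) ≤ (stepIndex m x + 1) / (m + 1) := by
  rw [le_div_iff₀ (by positivity), mul_comm]
  rcases min_choice ⌊((m : ℝ) + 1) * x⌋₊ m with h | h
  · have : (stepIndex m x : ℕ) = ⌊((m : ℝ) + 1) * x⌋₊ := h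
    rw [this]
    exact (Nat.lt_floor_add_one _).le
  · have : (stepIndex m x : ℕ) = m := h
    rw [this]
    exact mul_le_of_le_one_right (by positivity) x.2.2

theorem stepIndex_eq_of_mem {x : I} {k : Fin (m + 1)} (hx : x ∈ stepInterval m k) :
    stepIndex m x = k := by
  obtain ⟨h1, h2⟩ := hx
  rw [div_le_iff₀ (by positivity)] at h1
  rw [lt_div_iff₀ (by positivity)] at h2
  have : ⌊((m : ℝ) + 1) * x⌋₊ = k := by
    rw [Nat.floor_eq_iff (mul_nonneg (by positivity) x.2.1), mul_comm]
    exact ⟨h1, h2⟩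
  ext
  simp only [stepIndex, this]
  exact min_eq_left (Nat.lt_succ_iff.1 k.2)

/-- The point 1 lies in no half-open step interval although `stepIndex` assigns it the index m;
hence the restriction, and the almost everywhere statements below. -/
theorem mem_stepInterval_iff {x : I} (hx : (x : ℝ) < 1) {k : Fin (m + 1)} :
    x ∈ stepInterval m k ↔ stepIndex m x = k := by
  refine ⟨stepIndex_eq_of_mem, ?_⟩
  rintro rfl
  refine ⟨stepIndex_div_le x, ?_⟩
  rw [lt_div_iff₀ (by positivity), mul_comm]
  rcases min_choice ⌊((m : ℝ) + 1) * x⌋₊ m with h | h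
  · have : (stepIndex m x : ℕ) = ⌊((m : ℝ) + 1) * x⌋₊ := h
    rw [this]
    exact Nat.lt_floor_add_one _
  · have : (stepIndex m x : ℕ) = m := h
    rw [this]
    exact mul_lt_of_lt_one_right (by positivity) hx

theorem ae_coe_lt_one : ∀ᵐ x : I, (x : ℝ) < 1 := by
  have : ∀ᵐ x : I, x ≠ 1 := by simp [ae_iff]
  filter_upwards [this] with x hx
  exact lt_of_le_of_ne x.2.2 fun h => hx (Subtype.ext h)

theorem measurable_stepIndex : Measurable (stepIndex m) := by
  have h1 : Measurable fun n : ℕ => (⟨min n m, Nat.lt_succ_of_le (min_le_right _ _)⟩ :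
    Fin (m + 1)) := measurable_from_nat
  have h2 : Measurable fun x : I => ⌊((m : ℝ) + 1) * x⌋₊ :=
    Nat.measurable_floor.comp (by fun_prop)
  exact h1.comp h2

theorem volume_stepInterval (k : Fin (m + 1)) :
    volume (stepInterval m k) = ENNReal.ofReal (1 / ((m : ℝ) + 1)) := by
  have h : stepInterval m k = ((↑) : I → ℝ) ⁻¹' Ico ((k : ℝ) / (m + 1)) ((k + 1) / (m + 1)) := rfl
  have hk : (k : ℝ) + 1 ≤ m + 1 := by exact_mod_cast k.2
  rw [h, unitInterval.measurePreserving_coe.measure_preimage measurableSet_Ico.nullMeasurableSet,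
    Measure.restrict_apply measurableSet_Ico, inter_eq_left.2, Real.volume_Ico]
  · congr 1
    ring
  · intro y hy
    refine ⟨le_trans (by positivity) hy.1, hy.2.le.trans ?_⟩
    rw [div_le_one (by positivity)]
    exact hk

theorem stepInterval_ae_eq (k : Fin (m + 1)) :
    stepInterval m k =ᵐ[volume] stepIndex m ⁻¹' {k} := by
  filter_upwards [ae_coe_lt_one] with x hx
  exact propext (mem_stepInterval_iff hx)

theorem integral_comp_stepIndex (u : Fin (m + 1) → ℝ) :
    ∫ x : I, u (stepIndex m x) = 1 / ((m : ℝ) + 1) * ∑ k, u k := by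
  rw [← integral_map (f := u) measurable_stepIndex.aemeasurable
    measurable_from_top.aestronglyMeasurable, integral_fintype, Finset.mul_sum]
  · refine Finset.sum_congr rfl fun k _ => ?_
    rw [map_measureReal_apply measurable_stepIndex (measurableSet_singleton k),
      ← measureReal_congr (stepInterval_ae_eq k), measureReal_def, volume_stepInterval,
      ENNReal.toReal_ofReal (by positivity), smul_eq_mul]
  · have := Measure.isProbabilityMeasure_map (μ := (volume : Measure I))
      (measurable_stepIndex (m := m)).aemeasurable
    exact .of_finite

theorem coeFn_stepMap (a : Fin (m + 1) → ℝ) :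
    stepMap m a =ᵐ[volume] fun x => a (stepIndex m x) := by
  have h : ∀ᵐ x : I, ∀ k, indicatorConstLp 2 (measurableSet_stepInterval m k)
      (measure_ne_top (volume : Measure I) _) (a k) x =
        (stepInterval m k).indicator (fun _ => a k) x := by
    rw [ae_all_iff]
    exact fun k => indicatorConstLp_coeFn
  filter_upwards [h, ae_coe_lt_one, Lp.coeFn_finsetSum Finset.univ
    (fun k => indicatorConstLp 2 (measurableSet_stepInterval m k)
      (measure_ne_top (volume : Measure I) _) (a k))] with x h1 h2 h3
  rw [stepMap, h3, Finset.sum_apply, Finset.sum_eq_single (stepIndex m x)]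
  · rw [h1, indicator_of_mem ((mem_stepInterval_iff h2).2 rfl)]
  · intro k _ hk
    rw [h1, indicator_of_notMem fun hx => hk (stepIndex_eq_of_mem hx).symm]
  · simp

/-- `stepMap` as a linear map. -/
noncomputable def stepLinear (m : ℕ) : (Fin (m + 1) → ℝ) →ₗ[ℝ] L2I where
  toFun := stepMap m
  map_add' a b := by
    refine Lp.ext ?_
    filter_upwards [coeFn_stepMap (a + b), coeFn_stepMap a, coeFn_stepMap b,
      Lp.coeFn_add (stepMap m a) (stepMap m b)] with x h1 h2 h3 h4
    rw [h1, h4, Pi.add_apply, Pi.add_apply, h2, h3]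
  map_smul' r a := by
    refine Lp.ext ?_
    filter_upwards [coeFn_stepMap (r • a), coeFn_stepMap a,
      Lp.coeFn_smul r (stepMap m a)] with x h1 h2 h3
    rw [h1, RingHom.id_apply, h3, Pi.smul_apply, Pi.smul_apply, h2]

theorem stepMap_sub (a b : Fin (m + 1) → ℝ) : stepMap m (a - b) = stepMap m a - stepMap m b :=
  (stepLinear m).map_sub a b

theorem norm_stepMap_sq (a : Fin (m + 1) → ℝ) :
    ‖stepMap m a‖ ^ 2 = 1 / ((m : ℝ) + 1) * ∑ k, a k ^ 2 := by
  rw [← real_inner_self_eq_norm_sq, L2.inner_def, ← integral_comp_stepIndex fun k => a k ^ 2]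
  refine integral_congr_ae ?_
  filter_upwards [coeFn_stepMap a] with x hx
  rw [hx]
  simp [sq]

theorem norm_stepMap_comp_perm (a : Fin (m + 1) → ℝ) (τ : Equiv.Perm (Fin (m + 1))) :
    ‖stepMap m (a ∘ τ)‖ = ‖stepMap m a‖ := by
  rw [← sq_eq_sq₀ (norm_nonneg _) (norm_nonneg _), norm_stepMap_sq, norm_stepMap_sq]
  congr 1
  exact Equiv.sum_comp τ fun k => a k ^ 2

theorem sum_setIntegral_stepInterval {g : I → ℝ} (hg : Integrable g) :
    ∑ k, ∫ x in stepInterval m k, g x = ∫ x, g x := by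
  simp only [← integral_indicator (measurableSet_stepInterval m _)]
  rw [← integral_finsetSum _ fun k _ => hg.indicator (measurableSet_stepInterval m k)]
  refine integral_congr_ae ?_
  filter_upwards [ae_coe_lt_one] with x hx
  rw [Finset.sum_eq_single (stepIndex m x)]
  · rw [indicator_of_mem ((mem_stepInterval_iff hx).2 rfl)]
  · intro k _ hk
    rw [indicator_of_notMem fun hx => hk (stepIndex_eq_of_mem hx).symm]
  · simp

/-- The averages of `g` over the step intervals. -/
noncomputable def stepAverage (m : ℕ) (g : I → ℝ) (k : Fin (m + 1)) : ℝ :=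
  ((m : ℝ) + 1) * ∫ x in stepInterval m k, g x

theorem stepAverage_congr {g h : I → ℝ} (hgh : g =ᵐ[volume] h) :
    stepAverage m g = stepAverage m h := by
  ext k
  rw [stepAverage, stepAverage, integral_congr_ae (ae_restrict_of_ae hgh)]

theorem setIntegral_stepMap (a : Fin (m + 1) → ℝ) (k : Fin (m + 1)) :
    ∫ x in stepInterval m k, stepMap m a x = 1 / ((m : ℝ) + 1) * a k := by
  rw [setIntegral_congr_ae (g := fun _ => a k) (measurableSet_stepInterval m k),
    setIntegral_const, measureReal_def, volume_stepInterval,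
    ENNReal.toReal_ofReal (by positivity), smul_eq_mul]
  filter_upwards [coeFn_stepMap a] with x hx hk
  rw [hx, stepIndex_eq_of_mem hk]

theorem stepAverage_stepMap (a : Fin (m + 1) → ℝ) : stepAverage m (stepMap m a) = a := by
  ext k
  rw [stepAverage, setIntegral_stepMap]
  field_simp

theorem inner_stepMap (a : Fin (m + 1) → ℝ) (g : L2I) :
    inner ℝ (stepMap m a) g = 1 / ((m : ℝ) + 1) * ∑ k, a k * stepAverage m g k := by
  rw [stepMap, sum_inner, Finset.mul_sum]
  refine Finset.sum_congr rfl fun k _ => ?_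
  rw [L2.inner_indicatorConstLp_eq_inner_setIntegral, stepAverage, real_inner_eq_re_inner]
  simp only [RCLike.inner_apply, conj_trivial, RCLike.re_to_real]
  field_simp

/-- Pythagoras: averaging is the orthogonal projection onto the step functions. It is therefore a
contraction and gives the best approximation. -/
theorem norm_sub_stepMap_sq (g : L2I) (c : Fin (m + 1) → ℝ) :
    ‖g - stepMap m c‖ ^ 2 = ‖g - stepMap m (stepAverage m g)‖ ^ 2 +
      ‖stepMap m (stepAverage m g - c)‖ ^ 2 := by
  have h : inner ℝ (g - stepMap m (stepAverage m g)) (stepMap m (stepAverage m g - c)) = 0 := by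
    rw [real_inner_comm, inner_sub_right, inner_stepMap, inner_stepMap, stepAverage_stepMap,
      sub_self]
  have h2 := norm_add_sq_eq_norm_sq_add_norm_sq_of_inner_eq_zero _ _ h
  rw [← sq, ← sq, ← sq] at h2
  rw [← h2, stepMap_sub]
  congr 2
  abel

theorem norm_sub_stepAverage_le (g : L2I) (c : Fin (m + 1) → ℝ) :
    ‖g - stepMap m (stepAverage m g)‖ ≤ ‖g - stepMap m c‖ := by
  rw [← sq_le_sq₀ (norm_nonneg _) (norm_nonneg _), norm_sub_stepMap_sq g c]
  linarith [sq_nonneg ‖stepMap m (stepAverage m g - c)‖]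

theorem norm_stepAverage_le (g : L2I) : ‖stepMap m (stepAverage m g)‖ ≤ ‖g‖ := by
  have h := norm_sub_stepMap_sq g (0 : Fin (m + 1) → ℝ)
  have h0 : stepMap m 0 = 0 := (stepLinear m).map_zero
  rw [h0, sub_zero, sub_zero] at h
  rw [← sq_le_sq₀ (norm_nonneg _) (norm_nonneg _), h]
  linarith [sq_nonneg ‖g - stepMap m (stepAverage m g)‖]

theorem exists_norm_toLp_sub_stepMap_le (h : C(I, ℝ)) {ε : ℝ} (hε : 0 < ε) :
    ∀ᶠ m in atTop, ∃ c, ‖ContinuousMap.toLp 2 (volume : Measure I) ℝ h - stepMap m c‖ ≤ ε := by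
  obtain ⟨δ, hδ, H⟩ := Metric.uniformContinuous_iff.1
    (CompactSpace.uniformContinuous_of_continuous h.continuous) ε hε
  obtain ⟨M, hM⟩ := exists_nat_one_div_lt hδ
  filter_upwards [eventually_ge_atTop M] with m hm
  have hmem : ∀ k : Fin (m + 1), (k : ℝ) / (m + 1) ∈ I := fun k => by
    refine ⟨by positivity, ?_⟩
    rw [div_le_one (by positivity)]
    exact_mod_cast k.2.le
  refine ⟨fun k => h ⟨(k : ℝ) / (m + 1), hmem k⟩, ?_⟩
  refine (Lp.norm_le_of_ae_bound hε.le ?_).trans_eq (b := (measureUnivNNReal (volume : Measure I)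
    : ℝ) ^ (2 : ℝ≥0∞).toReal⁻¹ * ε) ?_
  · filter_upwards [ContinuousMap.coeFn_toLp (p := 2) (𝕜 := ℝ) (volume : Measure I) h,
      Lp.coeFn_sub (ContinuousMap.toLp 2 (volume : Measure I) ℝ h)
        (stepMap m fun k => h ⟨(k : ℝ) / (m + 1), hmem k⟩),
      coeFn_stepMap fun k : Fin (m + 1) => h ⟨(k : ℝ) / (m + 1), hmem k⟩] with x h1 h2 h3
    rw [h2, Pi.sub_apply, h1, h3, ← dist_eq_norm]
    refine (H ?_).le
    have e1 := stepIndex_div_le (m := m) x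
    have e2 := le_stepIndex_add_one_div (m := m) x
    have e3 : 1 / ((m : ℝ) + 1) ≤ 1 / ((M : ℝ) + 1) := by
      apply one_div_le_one_div_of_le (by positivity)
      gcongr
    rw [add_div] at e2
    rw [Subtype.dist_eq, Real.dist_eq, abs_of_nonneg (sub_nonneg.2 e1)]
    linarith
  · simp [measureUnivNNReal]

/-- Continuous functions are dense and, by uniform continuity, close to the step functions of their
values at left endpoints; the average of g does at least as well as any such step function. -/
theorem tendsto_stepAverage (g : L2I) :
    Tendsto (fun m => stepMap m (stepAverage m g)) atTop (𝓝 g) := by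
  rw [Metric.tendsto_atTop']
  intro ε hε
  obtain ⟨h, hh⟩ := Metric.denseRange_iff.1
    (ContinuousMap.toLp_denseRange ℝ (volume : Measure I) (p := 2) ℝ (by norm_num)) g (ε / 2)
    (half_pos hε)
  obtain ⟨M, hM⟩ := eventually_atTop.1 (exists_norm_toLp_sub_stepMap_le h (half_pos hε))
  refine ⟨M, fun m hm => ?_⟩
  obtain ⟨c, hc⟩ := hM m (le_of_lt hm)
  rw [dist_comm, dist_eq_norm]
  rw [dist_eq_norm] at hh
  refine (norm_sub_stepAverage_le g c).trans_lt ?_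
  calc ‖g - stepMap m c‖ = ‖(g - ContinuousMap.toLp 2 (volume : Measure I) ℝ h) +
        (ContinuousMap.toLp 2 (volume : Measure I) ℝ h - stepMap m c)‖ := by congr 1; abel
    _ ≤ _ := norm_add_le _ _
    _ < ε := by linarith

end

section

/-! ### Step averages of majorized functions -/

variable {m : ℕ} {f : CP1 → ℝ}

theorem stepAverage_rearr (k : Fin (m + 1)) :
    stepAverage m (rearr f) k = ((m : ℝ) + 1) * ∫ z in ((k : ℕ) : ℝ) / (m + 1)..
      (((k : ℕ) + 1 : ℕ) : ℝ) / (m + 1), decreasingRearrangement areaMeasure f z := by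
  have hk : ((k : ℕ) : ℝ) + 1 ≤ m + 1 := by exact_mod_cast k.2
  have hs : Ico (((k : ℕ) : ℝ) / (m + 1)) ((((k : ℕ) + 1 : ℕ) : ℝ) / (m + 1)) ⊆ Icc 0 1 := by
    intro y hy
    refine ⟨le_trans (by positivity) hy.1, hy.2.le.trans ?_⟩
    rw [div_le_one (by positivity)]
    exact_mod_cast k.2
  have h : stepInterval m k = ((↑) : I → ℝ) ⁻¹'
      Ico (((k : ℕ) : ℝ) / (m + 1)) ((((k : ℕ) + 1 : ℕ) : ℝ) / (m + 1)) := by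
    rw [Nat.cast_add_one]
    rfl
  rw [stepAverage, h]
  congr 1
  refine (unitInterval.measurePreserving_coe.setIntegral_preimage_emb
    unitInterval.measurableEmbedding_coe (decreasingRearrangement areaMeasure f) _).trans ?_
  rw [Measure.restrict_restrict_of_subset hs, integral_Ico_eq_integral_Ioc,
    intervalIntegral.integral_of_le]
  gcongr
  omega

theorem sum_stepAverage_rearr (hf : IsSmooth f) {k : ℕ} (hk : k ≤ m) :
    ∑ j ∈ Finset.univ.filter (fun j : Fin (m + 1) => j.val < k), stepAverage m (rearr f) j =
      ((m : ℝ) + 1) * ∫ z in (0 : ℝ)..(k : ℝ) / (m + 1),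
        decreasingRearrangement areaMeasure f z := by
  simp only [stepAverage_rearr]
  rw [sum_filter_val_lt (fun i : ℕ => ((m : ℝ) + 1) * ∫ z in (i : ℝ) / (m + 1)..
      ((i + 1 : ℕ) : ℝ) / (m + 1), decreasingRearrangement areaMeasure f z) (by omega),
    ← Finset.mul_sum, intervalIntegral.sum_integral_adjacent_intervals
      (a := fun i : ℕ => (i : ℝ) / (m + 1))]
  · simp
  · intro i hi
    refine intervalIntegrable_decreasingRearrangement hf.integrable (by positivity) ?_ ?_
    · gcongr
      omega
    · rw [div_le_one (by positivity)]
      exact_mod_cast (by omega : i + 1 ≤ m + 1)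

theorem sum_stepAverage {g : I → ℝ} (hg : Integrable g) :
    ∑ k, stepAverage m g k = ((m : ℝ) + 1) * ∫ x, g x := by
  simp only [stepAverage]
  rw [← Finset.mul_sum, sum_setIntegral_stepInterval hg]

/-- The bound g ≤ t + (g - t)⁺ is used on the chosen intervals only, and the positive part is then
enlarged to all of [0,1]. -/
theorem sum_stepAverage_le {g : I → ℝ} (hg : Integrable g) (S : Finset (Fin (m + 1))) (t : ℝ) :
    ∑ k ∈ S, stepAverage m g k ≤ ((m : ℝ) + 1) * ((S.card : ℝ) / (m + 1) * t +
      ∫ x, max (g x - t) 0) := by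
  have hp := hg.sub_const_pos_part t
  simp only [stepAverage]
  rw [← Finset.mul_sum]
  refine mul_le_mul_of_nonneg_left ?_ (by positivity)
  calc ∑ k ∈ S, ∫ x in stepInterval m k, g x
      ≤ ∑ k ∈ S, (1 / ((m : ℝ) + 1) * t + ∫ x in stepInterval m k, max (g x - t) 0) := by
        refine Finset.sum_le_sum fun k _ => ?_
        have h1 : ∫ x in stepInterval m k, (t + max (g x - t) 0) =
            1 / ((m : ℝ) + 1) * t + ∫ x in stepInterval m k, max (g x - t) 0 := by
          rw [integral_add (integrable_const _) hp.integrableOn, setIntegral_const,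
            measureReal_def, volume_stepInterval, ENNReal.toReal_ofReal (by positivity),
            smul_eq_mul]
        rw [← h1]
        refine integral_mono hg.integrableOn ((integrable_const t).add hp.integrableOn)
          fun x => ?_
        change g x ≤ t + max (g x - t) 0
        linarith [le_max_left (g x - t) 0]
    _ = (S.card : ℝ) / (m + 1) * t + ∑ k ∈ S, ∫ x in stepInterval m k, max (g x - t) 0 := by
        rw [Finset.sum_add_distrib, Finset.sum_const, nsmul_eq_mul]
        ring
    _ ≤ (S.card : ℝ) / (m + 1) * t + ∫ x, max (g x - t) 0 := by
        rw [← sum_setIntegral_stepInterval (m := m) hp]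
        refine add_le_add_right (Finset.sum_le_sum_of_subset_of_nonneg (Finset.subset_univ _)
          fun k _ _ => ?_) _
        exact setIntegral_nonneg (measurableSet_stepInterval m k) fun _ _ => le_max_right _ _

theorem sum_stepAverage_comp_perm_le (hf : IsSmooth f) {g : L2I} (hg : g ∈ majorizedSet f)
    (τ : Equiv.Perm (Fin (m + 1))) {k : ℕ} (hk : k ≤ m) :
    ∑ j ∈ Finset.univ.filter (fun j : Fin (m + 1) => j.val < k), stepAverage m g (τ j) ≤
      ∑ j ∈ Finset.univ.filter (fun j : Fin (m + 1) => j.val < k),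
        stepAverage m (rearr f) j := by
  rw [sum_stepAverage_rearr hf hk]
  rcases k.eq_zero_or_pos with rfl | hpos
  · simp
  have hs : (k : ℝ) / (m + 1) ∈ Ioo (0 : ℝ) 1 := by
    refine ⟨by positivity, ?_⟩
    rw [div_lt_one (by positivity)]
    exact_mod_cast (by omega : k < m + 1)
  rw [integral_decreasingRearrangement_eq_self hf.integrable hs]
  -- At this level the duality formula for f is an equality, so the upper bound for g matches the
  -- partial integral of f^*.
  set t := decreasingRearrangement areaMeasure f ((k : ℝ) / (m + 1))
  have hcard : (Finset.univ.filter (fun j : Fin (m + 1) => j.val < k)).card = k := by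
    have h := sum_filter_val_lt (fun _ => 1) (n := m + 1) (k := k) (by omega)
    simp only [Finset.sum_const, nsmul_eq_mul, mul_one, Finset.card_range] at h
    exact_mod_cast h
  have h := sum_stepAverage_le (m := m) (integrable_coeFn g)
    ((Finset.univ.filter (fun j : Fin (m + 1) => j.val < k)).map τ.toEmbedding) t
  rw [Finset.sum_map, Finset.card_map, hcard] at h
  refine h.trans (mul_le_mul_of_nonneg_left ?_ (by positivity))
  exact add_le_add_right (((mem_majorizedSet_iff hf g).1 hg).1 t) _

theorem sum_stepAverage_eq (hf : IsSmooth f) {g : L2I} (hg : g ∈ majorizedSet f) :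
    ∑ j, stepAverage m g j = ∑ j, stepAverage m (rearr f) j := by
  rw [sum_stepAverage (integrable_coeFn g),
    sum_stepAverage (hf.memLp_rearr.integrable (by norm_num)), hf.identDistrib_rearr.integral_eq,
    ((mem_majorizedSet_iff hf g).1 hg).2]

theorem stepAverage_mem_permutohedron (hf : IsSmooth f) {g : L2I} (hg : g ∈ majorizedSet f) :
    stepAverage m g ∈ permutohedron (stepAverage m (rearr f)) :=
  mem_permutohedron (fun τ _ hk => sum_stepAverage_comp_perm_le hf hg τ hk)
    (sum_stepAverage_eq hf hg)

/-! ### Second moments and permutohedra of majorized vectors -/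

theorem norm_rearrL2_sq (hf : IsSmooth f) :
    ‖rearrL2 f hf‖ ^ 2 = ∫ p, f p ^ 2 ∂areaMeasure := by
  rw [← real_inner_self_eq_norm_sq, L2.inner_def]
  refine Eq.trans ?_
    (hf.identDistrib_rearr.comp (u := fun y : ℝ => y ^ 2) (by fun_prop)).integral_eq
  refine integral_congr_ae ?_
  filter_upwards [hf.memLp_rearr.coeFn_toLp] with x hx
  rw [rearrL2, hx]
  simp [sq]

theorem stepAverage_rearrL2 (hf : IsSmooth f) :
    stepAverage m (rearrL2 f hf) = stepAverage m (rearr f) :=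
  stepAverage_congr hf.memLp_rearr.coeFn_toLp

/-- With b the averages of f^*, expand the square: Abel summation gives ⟨l, b⟩ ≥ ⟨l, l⟩, leaving
‖b‖² - ‖l‖², and averaging contracts f^* to b. Convergence of second moments thus forces convergence
in norm. -/
theorem norm_stepMap_sub_sq_le (hf : IsSmooth f) {l : Fin (m + 1) → ℝ} (hl : Antitone l)
    (hmem : stepMap m l ∈ majorizedSet f) :
    ‖stepMap m (stepAverage m (rearr f) - l)‖ ^ 2 ≤
      ∫ p, f p ^ 2 ∂areaMeasure - 1 / ((m : ℝ) + 1) * ∑ k, l k ^ 2 := by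
  set b := stepAverage m (rearr f)
  have h1 : ∑ j, l j * l j ≤ ∑ j, l j * b j := by
    refine sum_mul_le_sum_mul_of_antitone hl (fun k hk => ?_) ?_
    · have := sum_stepAverage_comp_perm_le hf hmem 1 hk
      rwa [stepAverage_stepMap] at this
    · have := sum_stepAverage_eq (m := m) hf hmem
      rwa [stepAverage_stepMap] at this
  have h2 : 1 / ((m : ℝ) + 1) * ∑ k, b k ^ 2 ≤ ∫ p, f p ^ 2 ∂areaMeasure := by
    rw [← norm_stepMap_sq, ← norm_rearrL2_sq hf, sq_le_sq₀ (norm_nonneg _) (norm_nonneg _)]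
    have := norm_stepAverage_le (m := m) (rearrL2 f hf)
    rwa [stepAverage_rearrL2] at this
  have h3 : ∑ k, (b - l) k ^ 2 = ∑ k, b k ^ 2 - 2 * ∑ k, l k * b k + ∑ k, l k * l k := by
    rw [Finset.mul_sum, ← Finset.sum_sub_distrib, ← Finset.sum_add_distrib]
    refine Finset.sum_congr rfl fun k _ => ?_
    rw [Pi.sub_apply]
    ring
  have h4 : ∑ k, l k ^ 2 = ∑ k, l k * l k := Finset.sum_congr rfl fun k _ => sq _
  have h5 : 1 / ((m : ℝ) + 1) * ∑ k, (b - l) k ^ 2 ≤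
      1 / ((m : ℝ) + 1) * (∑ k, b k ^ 2 - ∑ k, l k ^ 2) := by
    refine mul_le_mul_of_nonneg_left ?_ (by positivity)
    rw [h3, h4]
    linarith
  rw [norm_stepMap_sq]
  rw [mul_sub] at h5
  linarith

theorem integral_comp_stepMap (l : Fin (m + 1) → ℝ) (u : ℝ → ℝ) :
    ∫ x, u (stepMap m l x) = 1 / ((m : ℝ) + 1) * ∑ k, u (l k) := by
  rw [← integral_comp_stepIndex fun k => u (l k)]
  refine integral_congr_ae ?_
  filter_upwards [coeFn_stepMap l] with x hx
  rw [hx]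

/-- Permuting the values preserves the law of the step function, so the vertices stay in the set;
convexity does the rest. -/
theorem image_permutohedron_subset (hf : IsSmooth f) {l : Fin (m + 1) → ℝ}
    (hmem : stepMap m l ∈ majorizedSet f) : stepMap m '' permutohedron l ⊆ majorizedSet f := by
  rw [image_subset_iff]
  refine convexHull_min ?_ ((convex_majorizedSet hf).linear_preimage (stepLinear m))
  rintro _ ⟨τ, rfl⟩
  change stepMap m (l ∘ τ) ∈ majorizedSet f
  rw [mem_majorizedSet_iff hf] at hmem ⊢
  have h : ∀ u : ℝ → ℝ, ∫ x, u (stepMap m (l ∘ τ) x) = ∫ x, u (stepMap m l x) := fun u => by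
    rw [integral_comp_stepMap, integral_comp_stepMap]
    congr 1
    exact Equiv.sum_comp τ fun k => u (l k)
  exact ⟨fun t => (h fun y => max (y - t) 0).trans_le (hmem.1 t), (h id).trans hmem.2⟩

open scoped Pointwise in
-- The closed δ-neighbourhood K + B(0, δ) is convex, so vertices suffice.
theorem exists_norm_stepMap_sub_le {K : Set L2I} (hK : Convex ℝ K) {b : Fin (m + 1) → ℝ} {δ : ℝ}
    (h : ∀ τ : Equiv.Perm (Fin (m + 1)), ∃ u ∈ K, ‖stepMap m (b ∘ τ) - u‖ ≤ δ)
    {a : Fin (m + 1) → ℝ} (ha : a ∈ permutohedron b) : ∃ u ∈ K, ‖stepMap m a - u‖ ≤ δ := by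
  have hC : Convex ℝ (K + Metric.closedBall (0 : L2I) δ) := hK.add (convex_closedBall 0 δ)
  have hsub : permutohedron b ⊆ stepLinear m ⁻¹' (K + Metric.closedBall (0 : L2I) δ) := by
    refine convexHull_min ?_ (hC.linear_preimage (stepLinear m))
    rintro _ ⟨τ, rfl⟩
    obtain ⟨u, hu, hd⟩ := h τ
    exact ⟨u, hu, stepMap m (b ∘ τ) - u, by simpa using hd, add_sub_cancel _ _⟩
  obtain ⟨u, hu, v, hv, huv⟩ := hsub ha
  refine ⟨u, hu, ?_⟩
  have : stepMap m a = u + v := huv.symm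
  rw [this, add_sub_cancel_left]
  simpa using hv

/-! ### Permutations of the step intervals as measure preserving maps -/

/-- The map of `[0,1]` that translates the `k`-th step interval to the `τ k`-th one. -/
noncomputable def intervalPerm (m : ℕ) (τ : Equiv.Perm (Fin (m + 1))) (x : I) : I :=
  ⟨x + ((τ (stepIndex m x) : ℝ) - stepIndex m x) / (m + 1), by
    have h1 := stepIndex_div_le (m := m) x
    have h2 := le_stepIndex_add_one_div (m := m) x
    rw [add_div] at h2
    have h3 : 0 ≤ (τ (stepIndex m x) : ℝ) / (m + 1) := by positivity
    have h4 : (τ (stepIndex m x) : ℝ) / (m + 1) + 1 / (m + 1) ≤ 1 := by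
      rw [← add_div, div_le_one (by positivity)]
      exact_mod_cast (τ (stepIndex m x)).2
    rw [sub_div]
    constructor <;> linarith⟩

theorem coe_intervalPerm (τ : Equiv.Perm (Fin (m + 1))) (x : I) :
    (intervalPerm m τ x : ℝ) = x + ((τ (stepIndex m x) : ℝ) - stepIndex m x) / (m + 1) := rfl

theorem measurable_intervalPerm (τ : Equiv.Perm (Fin (m + 1))) :
    Measurable (intervalPerm m τ) := by
  refine Measurable.subtype_mk (measurable_subtype_coe.add ?_)
  exact (measurable_from_top (f := fun k : Fin (m + 1) => ((τ k : ℝ) - k) / (m + 1))).comp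
    measurable_stepIndex

theorem intervalPerm_mem {τ : Equiv.Perm (Fin (m + 1))} {x : I} {k : Fin (m + 1)}
    (hx : x ∈ stepInterval m k) : intervalPerm m τ x ∈ stepInterval m (τ k) := by
  have h := stepIndex_eq_of_mem hx
  obtain ⟨h1, h2⟩ := hx
  rw [add_div] at h2
  simp only [stepInterval, mem_ofPred_eq, coe_intervalPerm, h, sub_div, add_div]
  constructor <;> linarith

/-- On a single step interval the map is a translation, and Lebesgue measure is translation
invariant. -/
theorem volume_preimage_intervalPerm_inter (τ : Equiv.Perm (Fin (m + 1))) (A : Set I)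
    (k : Fin (m + 1)) : volume (intervalPerm m τ ⁻¹' A ∩ stepInterval m k) =
      volume (A ∩ stepInterval m (τ k)) := by
  rw [unitInterval.volume_apply, unitInterval.volume_apply,
    ← measure_preimage_add_right volume (((τ k : ℝ) - k) / (m + 1))
      ((↑) '' (A ∩ stepInterval m (τ k)))]
  congr 1
  ext y
  constructor
  · rintro ⟨x, ⟨hxA, hx⟩, rfl⟩
    refine ⟨intervalPerm m τ x, ⟨hxA, intervalPerm_mem hx⟩, ?_⟩
    rw [coe_intervalPerm, stepIndex_eq_of_mem hx]
  · rintro ⟨z, ⟨hzA, hz1, hz2⟩, hzy⟩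
    simp only [sub_div] at hzy
    rw [add_div] at hz2
    have hk : (k : ℝ) / (m + 1) + 1 / (m + 1) ≤ 1 := by
      rw [← add_div, div_le_one (by positivity)]
      exact_mod_cast k.2
    have hk0 : 0 ≤ (k : ℝ) / (m + 1) := by positivity
    have hy : y ∈ I := ⟨by linarith, by linarith⟩
    have hx : (⟨y, hy⟩ : I) ∈ stepInterval m k := by
      simp only [stepInterval, mem_ofPred_eq, add_div]
      constructor <;> linarith
    refine ⟨⟨y, hy⟩, ⟨?_, hx⟩, rfl⟩
    have : intervalPerm m τ ⟨y, hy⟩ = z := by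
      ext
      rw [coe_intervalPerm, stepIndex_eq_of_mem hx, sub_div]
      linarith
    rw [mem_preimage, this]
    exact hzA

theorem sum_volume_inter_stepInterval (m : ℕ) (A : Set I) :
    ∑ k : Fin (m + 1), volume (A ∩ stepInterval m k) = volume A := by
  have h := sum_measure_preimage_singleton (μ := (volume : Measure I).restrict A) Finset.univ
    (f := stepIndex m) fun k _ => measurable_stepIndex (measurableSet_singleton k)
  rw [Finset.coe_univ, preimage_univ, Measure.restrict_apply_univ] at h
  rw [← h]
  refine Finset.sum_congr rfl fun k _ => ?_
  rw [Measure.restrict_apply (measurable_stepIndex (measurableSet_singleton k)), inter_comm]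
  exact measure_congr ((stepInterval_ae_eq k).inter (ae_eq_refl A))

theorem measurePreserving_intervalPerm (τ : Equiv.Perm (Fin (m + 1))) :
    MeasurePreserving (intervalPerm m τ) volume volume := by
  refine ⟨measurable_intervalPerm τ, Measure.ext fun A hA => ?_⟩
  rw [Measure.map_apply (measurable_intervalPerm τ) hA,
    ← sum_volume_inter_stepInterval m (intervalPerm m τ ⁻¹' A),
    ← sum_volume_inter_stepInterval m A]
  simp only [volume_preimage_intervalPerm_inter]
  exact Equiv.sum_comp τ fun k => volume (A ∩ stepInterval m k)

theorem compMeasurePreserving_stepMap (τ : Equiv.Perm (Fin (m + 1))) (b : Fin (m + 1) → ℝ) :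
    Lp.compMeasurePreserving (intervalPerm m τ) (measurePreserving_intervalPerm τ) (stepMap m b) =
      stepMap m (b ∘ τ) := by
  have hφ := measurePreserving_intervalPerm τ
  refine Lp.ext ?_
  filter_upwards [Lp.coeFn_compMeasurePreserving (stepMap m b) hφ,
    hφ.quasiMeasurePreserving.ae_eq_comp (coeFn_stepMap b), coeFn_stepMap (b ∘ τ),
    ae_coe_lt_one] with x h1 h2 h3 h4
  rw [h1, h2, h3, Function.comp_apply, Function.comp_apply,
    stepIndex_eq_of_mem (intervalPerm_mem ((mem_stepInterval_iff h4).2 rfl))]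

/-! ### Filling the majorized set -/

theorem majorizedSet_subset_closedConvexHull (hf : IsSmooth f) :
    majorizedSet f ⊆ closedConvexHull ℝ (smeasOrbit f hf) := by
  intro g hg
  have key : ∀ m : ℕ, ∃ u ∈ convexHull ℝ (smeasOrbit f hf), ‖stepMap m (stepAverage m g) - u‖ ≤
      ‖stepMap m (stepAverage m (rearrL2 f hf)) - rearrL2 f hf‖ := by
    intro m
    have ha := stepAverage_mem_permutohedron (m := m) hf hg
    rw [← stepAverage_rearrL2 hf] at ha
    refine exists_norm_stepMap_sub_le (convex_convexHull ℝ _) (fun τ => ?_) ha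
    refine ⟨_, subset_convexHull ℝ _ ⟨intervalPerm m τ, measurePreserving_intervalPerm τ, rfl⟩, ?_⟩
    -- Composition with the interval exchange is an isometry, so the error is the same at every
    -- vertex: that of approximating f^* by its own averages.
    rw [← compMeasurePreserving_stepMap, ← map_sub, Lp.norm_compMeasurePreserving]
  choose u hu hd using key
  rw [closedConvexHull_eq_closure_convexHull]
  refine mem_closure_of_tendsto (b := atTop) (f := u) ?_ (Eventually.of_forall hu)
  have h1 := tendsto_stepAverage g
  have h2 : Tendsto (fun m => stepMap m (stepAverage m g) - u m) atTop (𝓝 0) := by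
    refine squeeze_zero_norm hd ?_
    have := (tendsto_stepAverage (rearrL2 f hf)).sub_const (rearrL2 f hf)
    rw [sub_self] at this
    simpa using this.norm
  simpa using h1.sub h2

theorem closedConvexHull_smeasOrbit (hf : IsSmooth f) :
    closedConvexHull ℝ (smeasOrbit f hf) = majorizedSet f :=
  (closedConvexHull_min (smeasOrbit_subset_majorizedSet hf) (convex_majorizedSet hf)
    (isClosed_majorizedSet hf)).antisymm (majorizedSet_subset_closedConvexHull hf)

/-- If the step functions of antitone vectors are majorized by `f` and their second moments
converge to that of `f`, then the images of their permutohedra fill the set majorized by `f`. -/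
theorem majorizedSet_subset_topLimsup (hf : IsSmooth f) {l : ∀ m : ℕ, Fin (m + 1) → ℝ}
    (hl : ∀ m, Antitone (l m)) (hmem : ∀ m, stepMap m (l m) ∈ majorizedSet f)
    (hlim : Tendsto (fun m : ℕ => 1 / ((m : ℝ) + 1) * ∑ k, l m k ^ 2) atTop
      (𝓝 (∫ p, f p ^ 2 ∂areaMeasure))) :
    majorizedSet f ⊆ topLimsup fun m => stepMap m '' permutohedron (l m) := by
  intro g hg
  have key : ∀ m : ℕ, ∃ u ∈ stepMap m '' permutohedron (l m),
      ‖stepMap m (stepAverage m g) - u‖ ≤ ‖stepMap m (stepAverage m (rearr f) - l m)‖ := by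
    intro m
    refine exists_norm_stepMap_sub_le ((convex_convexHull ℝ _).linear_image (stepLinear m))
      (fun τ => ?_) (stepAverage_mem_permutohedron (m := m) hf hg)
    refine ⟨_, mem_image_of_mem _ (subset_convexHull ℝ _ ⟨τ, rfl⟩), ?_⟩
    change ‖stepMap m (stepAverage m (rearr f) ∘ τ) - stepMap m (l m ∘ τ)‖ ≤ _
    rw [← stepMap_sub, ← norm_stepMap_comp_perm (stepAverage m (rearr f) - l m) τ]
    rfl
  choose u hu hd using key
  refine mem_topLimsup_of_tendsto hu ?_
  have h2 : Tendsto (fun m => stepMap m (stepAverage m g) - u m) atTop (𝓝 0) := by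
    refine squeeze_zero_norm hd ?_
    have h3 : Tendsto (fun m => ‖stepMap m (stepAverage m (rearr f) - l m)‖ ^ 2) atTop (𝓝 0) := by
      refine squeeze_zero (fun m => sq_nonneg _)
        (fun m => norm_stepMap_sub_sq_le hf (hl m) (hmem m)) ?_
      rw [← sub_self (∫ p, f p ^ 2 ∂areaMeasure)]
      exact hlim.const_sub _
    simpa using h3.sqrt
  simpa using (tendsto_stepAverage g).sub h2

end

/-! ### The inner products of the monomial sections -/

section RadialIntegral

variable {m j : ℕ}

theorem integrableOn_radial (hj : j ≤ m) :
    IntegrableOn (fun r : ℝ => r * (2 * (r ^ 2) ^ j / (1 + r ^ 2) ^ (m + 2))) (Ioi 0) := by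
  refine integrable_and_integral_radial.1.mono' ?_ ?_
  · refine Continuous.aestronglyMeasurable ?_
    refine continuous_id.mul (Continuous.div (by fun_prop) (by fun_prop) fun r => ?_)
    positivity
  · filter_upwards [ae_restrict_mem measurableSet_Ioi] with r hr
    have hr' : (0 : ℝ) < r := hr
    rw [Real.norm_of_nonneg (by positivity), pow_add, ← div_div]
    refine mul_le_mul_of_nonneg_left ?_ hr'.le
    gcongr
    rw [div_le_iff₀ (by positivity)]
    refine mul_le_mul_of_nonneg_left ?_ zero_le_two
    calc (r ^ 2) ^ j ≤ (1 + r ^ 2) ^ j := by gcongr; linarith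
      _ ≤ (1 + r ^ 2) ^ m := pow_le_pow_right₀ (by nlinarith [sq_nonneg r]) hj

/-- Integration by parts: the derivative of r^{2(j+1)}/(1+r²)^{m+1} is the difference of the
integrands, and j < m makes this function vanish at infinity. -/
theorem succ_mul_integral_radial (hj : j < m) :
    ((j : ℝ) + 1) * ∫ r in Ioi (0 : ℝ), r * (2 * (r ^ 2) ^ j / (1 + r ^ 2) ^ (m + 2)) =
      ((m : ℝ) - j) * ∫ r in Ioi (0 : ℝ), r * (2 * (r ^ 2) ^ (j + 1) / (1 + r ^ 2) ^ (m + 2)) := by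
  have hi1 := (integrableOn_radial hj.le).const_mul ((j : ℝ) + 1)
  have hi2 := (integrableOn_radial (m := m) (j := j + 1) hj).const_mul ((m : ℝ) - j)
  have hd : ∀ x ∈ Ioi (0 : ℝ), HasDerivAt (fun r : ℝ => (r ^ 2) ^ (j + 1) / (1 + r ^ 2) ^ (m + 1))
      (((j : ℝ) + 1) * (x * (2 * (x ^ 2) ^ j / (1 + x ^ 2) ^ (m + 2))) -
        ((m : ℝ) - j) * (x * (2 * (x ^ 2) ^ (j + 1) / (1 + x ^ 2) ^ (m + 2)))) x := by
    intro x _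
    have h0 : (1 + x ^ 2) ≠ 0 := by positivity
    have h1 : HasDerivAt (fun r : ℝ => r ^ 2) (2 * x) x := by simpa using hasDerivAt_pow 2 x
    have h2 := (h1.fun_pow (j + 1)).fun_div ((h1.const_add 1).fun_pow (m + 1))
      (pow_ne_zero _ h0)
    refine h2.congr_deriv ?_
    simp only [Nat.add_sub_cancel, Nat.cast_add, Nat.cast_one]
    field_simp
    ring
  have ht : Tendsto (fun r : ℝ => (r ^ 2) ^ (j + 1) / (1 + r ^ 2) ^ (m + 1)) atTop (𝓝 0) := by
    have h1 : Tendsto (fun r : ℝ => (1 + r ^ 2)⁻¹) atTop (𝓝 0) :=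
      (tendsto_atTop_add_const_left _ _ (tendsto_pow_atTop two_ne_zero)).inv_tendsto_atTop
    refine squeeze_zero (fun r => by positivity) (fun r => ?_) h1
    rw [pow_succ (1 + r ^ 2) m, div_le_iff₀ (by positivity), mul_comm _ (1 + r ^ 2),
      inv_mul_cancel_left₀ (by positivity)]
    calc (r ^ 2) ^ (j + 1) ≤ (1 + r ^ 2) ^ (j + 1) := by gcongr; linarith
      _ ≤ (1 + r ^ 2) ^ m := pow_le_pow_right₀ (by nlinarith [sq_nonneg r]) hj
  have hc : ContinuousWithinAt (fun r : ℝ => (r ^ 2) ^ (j + 1) / (1 + r ^ 2) ^ (m + 1))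
      (Ici 0) 0 := by
    refine (Continuous.div (by fun_prop) (by fun_prop) fun r => ?_).continuousWithinAt
    positivity
  have h := integral_Ioi_of_hasDerivAt_of_tendsto hc hd (hi1.sub hi2) ht
  rw [integral_sub hi1 hi2, integral_const_mul, integral_const_mul] at h
  simp only [ne_eq, OfNat.ofNat_ne_zero, not_false_eq_true, zero_pow, Nat.add_eq_zero_iff,
    one_ne_zero, and_false, zero_div, sub_zero] at h
  linarith

/-- The recursion shows that the integrals weighted by binomial coefficients do not depend on j. By
the binomial theorem the m+1 of them add up to the integral of 2r/(1+r²)², which is 1. -/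
theorem choose_mul_integral_radial (hj : j ≤ m) :
    ((m : ℝ) + 1) * ((m.choose j : ℝ) *
      ∫ r in Ioi (0 : ℝ), r * (2 * (r ^ 2) ^ j / (1 + r ^ 2) ^ (m + 2))) = 1 := by
  set J : ℕ → ℝ := fun j => (m.choose j : ℝ) *
    ∫ r in Ioi (0 : ℝ), r * (2 * (r ^ 2) ^ j / (1 + r ^ 2) ^ (m + 2)) with hJ
  have hconst : ∀ i ≤ m, J i = J 0 := by
    intro i
    induction i with
    | zero => simp
    | succ i ih =>
      intro hi
      rw [← ih (by omega)]
      have h1 := succ_mul_integral_radial (m := m) (j := i) hi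
      have h2 : (m.choose (i + 1) : ℝ) * (i + 1) = m.choose i * (m - i) := by
        have := Nat.choose_succ_right_eq m i
        rw [← Nat.cast_sub (by omega)]
        exact_mod_cast this
      have hi0 : ((i : ℝ) + 1) ≠ 0 := by positivity
      refine mul_left_cancel₀ hi0 ?_
      simp only [hJ]
      generalize ∫ r in Ioi (0 : ℝ), r * (2 * (r ^ 2) ^ i / (1 + r ^ 2) ^ (m + 2)) = A at h1 ⊢
      generalize ∫ r in Ioi (0 : ℝ), r * (2 * (r ^ 2) ^ (i + 1) / (1 + r ^ 2) ^ (m + 2)) = B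
        at h1 ⊢
      linear_combination B * h2 - m.choose i * h1
  have hsum : ∑ i ∈ Finset.range (m + 1), J i = 1 := by
    rw [← integrable_and_integral_radial.2]
    simp only [hJ, ← integral_const_mul]
    rw [← integral_finsetSum _ fun i hi => (integrableOn_radial (m := m) (j := i)
      (by rw [Finset.mem_range] at hi; omega)).const_mul _]
    refine setIntegral_congr_fun measurableSet_Ioi fun r _ => ?_
    have h0 : (1 + r ^ 2) ≠ 0 := by positivity
    have h1 : (1 + r ^ 2) ^ m = ∑ i ∈ Finset.range (m + 1), (r ^ 2) ^ i * (m.choose i : ℝ) := by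
      rw [add_comm, add_pow]
      simp
    calc ∑ i ∈ Finset.range (m + 1), (m.choose i : ℝ) *
          (r * (2 * (r ^ 2) ^ i / (1 + r ^ 2) ^ (m + 2)))
        = r * (2 * (∑ i ∈ Finset.range (m + 1), (r ^ 2) ^ i * (m.choose i : ℝ)) /
            (1 + r ^ 2) ^ (m + 2)) := by
          rw [Finset.mul_sum, Finset.sum_div, Finset.mul_sum]
          exact Finset.sum_congr rfl fun i _ => by ring
      _ = r * (2 / (1 + r ^ 2) ^ 2) := by
          rw [← h1, pow_add]
          field_simp
  rw [Finset.sum_congr rfl fun i hi => hconst i (by rw [Finset.mem_range] at hi; omega),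
    Finset.sum_const, Finset.card_range, nsmul_eq_mul] at hsum
  change ((m : ℝ) + 1) * J j = 1
  rw [hconst j hj]
  exact_mod_cast hsum

end RadialIntegral

section Integrals

variable {E : Type*} [NormedAddCommGroup E] [NormedSpace ℝ E]

theorem integral_fubiniStudy (u : ℂ → E) :
    ∫ w, u w ∂fubiniStudy = ∫ w, (2 / (1 + ‖w‖ ^ 2) ^ 2) • u w := by
  rw [fubiniStudy, integral_withDensity_eq_integral_toReal_smul
    measurable_fubiniStudy_density (by simp)]
  refine integral_congr_ae (Eventually.of_forall fun w => ?_)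
  simp only
  rw [ENNReal.toReal_ofReal (by positivity)]

theorem integral_sectionMeasure (m : ℕ) (u : ℂ → E) :
    ∫ w, u w ∂sectionMeasure m = ∫ w, (1 / (1 + ‖w‖ ^ 2) ^ m) • u w ∂fubiniStudy := by
  rw [sectionMeasure, integral_withDensity_eq_integral_toReal_smul (by fun_prop) (by simp)]
  refine integral_congr_ae (Eventually.of_forall fun w => ?_)
  simp only
  rw [ENNReal.toReal_ofReal (by positivity)]

theorem integral_sectionMeasure_eq_volume (m : ℕ) (u : ℂ → E) :
    ∫ w, u w ∂sectionMeasure m = ∫ w, (2 / (1 + ‖w‖ ^ 2) ^ (m + 2)) • u w := by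
  rw [integral_sectionMeasure, integral_fubiniStudy]
  refine integral_congr_ae (Eventually.of_forall fun w => ?_)
  simp only
  rw [smul_smul, pow_add]
  congr 1
  field_simp

/-- The measure is rotation invariant, so the integral equals ζ times itself. -/
theorem integral_sectionMeasure_eq_zero (m : ℕ) {u : ℂ → ℂ} {a : Circle} {ζ : ℂ} (hζ : ζ ≠ 1)
    (hu : ∀ w, u (a * w) = ζ * u w) : ∫ w, u w ∂sectionMeasure m = 0 := by
  rw [integral_sectionMeasure_eq_volume]
  set H : ℂ → ℂ := fun w => (2 / (1 + ‖w‖ ^ 2) ^ (m + 2)) • u w with hH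
  have h1 : ∫ w, H (rotation a w) = ∫ w, H w :=
    (rotation a).measurePreserving.integral_comp (rotation a).toHomeomorph.measurableEmbedding H
  have h2 : ∀ w, H (rotation a w) = ζ * H w := fun w => by
    simp only [hH, LinearIsometryEquiv.norm_map]
    rw [rotation_apply, hu, mul_smul_comm]
  simp only [h2] at h1
  rw [integral_const_mul] at h1
  have h3 : (ζ - 1) * ∫ w, H w = 0 := by rw [sub_mul, h1, one_mul, sub_self]
  exact (mul_eq_zero.1 h3).resolve_left (sub_ne_zero.2 hζ)

end Integrals

/-- The reciprocal `(m+1)/2π · binom(m,k)` of the squared norm of the section `w^k`. -/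
noncomputable def monomialWeight (m k : ℕ) : ℝ := ((m : ℝ) + 1) / (2 * Real.pi) * m.choose k

theorem integral_norm_pow_sectionMeasure {m k : ℕ} (hk : k ≤ m) :
    monomialWeight m k * ∫ w, (‖w‖ ^ 2) ^ k ∂sectionMeasure m = 1 := by
  rw [integral_sectionMeasure_eq_volume]
  have h := integral_fun_norm_addHaar (volume : Measure ℂ)
    fun r : ℝ => (2 / (1 + r ^ 2) ^ (m + 2)) • (r ^ 2) ^ k
  rw [h, measureReal_def, Complex.volume_ball, Complex.finrank_real_complex]
  have h2 : ∫ y in Ioi (0 : ℝ), y ^ (2 - 1) • (2 / (1 + y ^ 2) ^ (m + 2)) • (y ^ 2) ^ k =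
      ∫ r in Ioi (0 : ℝ), r * (2 * (r ^ 2) ^ k / (1 + r ^ 2) ^ (m + 2)) := by
    refine setIntegral_congr_fun measurableSet_Ioi fun r _ => ?_
    simp only [smul_eq_mul]
    ring
  rw [h2, monomialWeight]
  refine Eq.trans ?_ (choose_mul_integral_radial hk)
  generalize ∫ r in Ioi (0 : ℝ), r * (2 * (r ^ 2) ^ k / (1 + r ^ 2) ^ (m + 2)) = A
  have := Real.pi_ne_zero
  simp
  field_simp

theorem inner_monomialSection (m : ℕ) (j k : Fin (m + 1)) :
    monomialWeight m j * inner ℂ (monomialSection m j) (monomialSection m k) =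
      if j = k then (1 : ℂ) else 0 := by
  have h : inner ℂ (monomialSection m j) (monomialSection m k) =
      ∫ w : ℂ, (starRingEnd ℂ) w ^ (j : ℕ) * w ^ (k : ℕ) ∂sectionMeasure m := by
    rw [L2.inner_def]
    refine integral_congr_ae ?_
    filter_upwards [(memLp_monomial m j).coeFn_toLp, (memLp_monomial m k).coeFn_toLp] with w h1 h2
    rw [monomialSection, monomialSection, h1, h2, RCLike.inner_apply, map_pow, mul_comm]
  rw [h]
  split_ifs with hjk
  · subst hjk
    have h2 : ∀ w : ℂ, (starRingEnd ℂ) w ^ (j : ℕ) * w ^ (j : ℕ) =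
        (((‖w‖ ^ 2) ^ (j : ℕ) : ℝ) : ℂ) := fun w => by
      rw [← mul_pow, Complex.conj_mul']
      push_cast
      rfl
    simp only [h2]
    rw [integral_complex_ofReal, ← Complex.ofReal_mul,
      integral_norm_pow_sectionMeasure (Nat.lt_succ_iff.1 j.2), Complex.ofReal_one]
  · refine mul_eq_zero_of_right _ ?_
    have hne : ((k : ℝ) - j) ≠ 0 := by
      rw [sub_ne_zero]
      exact_mod_cast fun h : (k : ℕ) = j => hjk (Fin.ext h.symm)
    -- Rotation by π/(k - j) multiplies w̄^j w^k by e^{iπ} = -1.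
    refine integral_sectionMeasure_eq_zero m (a := Circle.exp (Real.pi / ((k : ℝ) - j)))
      (ζ := -1) (by norm_num) fun w => ?_
    set a := Circle.exp (Real.pi / ((k : ℝ) - j))
    have ha : (starRingEnd ℂ) (a : ℂ) ^ (j : ℕ) * (a : ℂ) ^ (k : ℕ) = -1 := by
      rw [Circle.coe_exp, ← Complex.exp_conj, ← Complex.exp_nat_mul, ← Complex.exp_nat_mul,
        ← Complex.exp_add, ← Complex.exp_pi_mul_I]
      congr 1
      have hne' : ((k : ℂ) - j) ≠ 0 := by exact_mod_cast hne
      simp only [map_mul, Complex.conj_I, Complex.conj_ofReal]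
      push_cast
      field_simp
      ring
    rw [← ha, map_mul, mul_pow, mul_pow]
    ring

/-! ### Coherent states -/

/-- The holomorphic section `z ↦ (m+1)/2π · (1 + w̄z)^m` representing evaluation at `w`. -/
noncomputable def coherentState (m : ℕ) (w : ℂ) : holSections m :=
  ∑ k : Fin (m + 1), ((monomialWeight m k : ℂ) * (starRingEnd ℂ) w ^ (k : ℕ)) •
    ⟨monomialSection m k, Submodule.subset_span ⟨k, rfl⟩⟩

theorem coe_coherentState (m : ℕ) (w : ℂ) : (coherentState m w : L2Sections m) =
    ∑ k : Fin (m + 1), ((monomialWeight m k : ℂ) * (starRingEnd ℂ) w ^ (k : ℕ)) •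
      monomialSection m k := by
  simp [coherentState]

theorem inner_coherentState_sum (m : ℕ) (w : ℂ) (c : Fin (m + 1) → ℂ) :
    inner ℂ (coherentState m w : L2Sections m) (∑ k, c k • monomialSection m k) =
      ∑ k : Fin (m + 1), c k * w ^ (k : ℕ) := by
  rw [coe_coherentState, sum_inner]
  refine Finset.sum_congr rfl fun j _ => ?_
  rw [inner_smul_left, inner_sum, Finset.mul_sum, Finset.sum_eq_single j]
  · have h := inner_monomialSection m j j
    rw [if_pos rfl] at h
    rw [inner_smul_right, map_mul, Complex.conj_ofReal, map_pow, Complex.conj_conj]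
    linear_combination (c j * w ^ (j : ℕ)) * h
  · intro k _ hk
    have h := inner_monomialSection m j k
    rw [if_neg (Ne.symm hk)] at h
    rw [inner_smul_right, map_mul, Complex.conj_ofReal, map_pow, Complex.conj_conj]
    linear_combination (c k * w ^ (j : ℕ)) * h
  · simp

theorem coeFn_sum_smul_monomialSection (m : ℕ) (c : Fin (m + 1) → ℂ) :
    ((∑ k, c k • monomialSection m k : L2Sections m) : ℂ → ℂ) =ᵐ[sectionMeasure m]
      fun w => ∑ k : Fin (m + 1), c k * w ^ (k : ℕ) := by
  have hk : ∀ᵐ w ∂(sectionMeasure m), ∀ k : Fin (m + 1),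
      (c k • monomialSection m k : L2Sections m) w = c k * w ^ (k : ℕ) := by
    rw [ae_all_iff]
    intro k
    filter_upwards [Lp.coeFn_smul (c k) (monomialSection m k),
      (memLp_monomial m k).coeFn_toLp] with w h1 h2
    rw [h1, Pi.smul_apply, monomialSection, h2, smul_eq_mul]
  filter_upwards [hk, Lp.coeFn_finsetSum Finset.univ
    (fun k => c k • monomialSection m k)] with w h1 h2
  rw [h2, Finset.sum_apply]
  exact Finset.sum_congr rfl fun k _ => h1 k

/-- The reproducing property of coherent states. -/
theorem ae_eq_inner_coherentState (m : ℕ) (s : holSections m) :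
    ∀ᵐ w ∂sectionMeasure m, (s : L2Sections m) w = inner ℂ (coherentState m w) s := by
  obtain ⟨c, hc⟩ := (Submodule.mem_span_range_iff_exists_fun ℂ).1 s.2
  filter_upwards [coeFn_sum_smul_monomialSection m c] with w hw
  rw [Submodule.coe_inner, ← hc, inner_coherentState_sum, hw]

theorem sum_monomialWeight_mul_pow (m : ℕ) (z : ℂ) :
    ∑ k : Fin (m + 1), (monomialWeight m k : ℂ) * z ^ (k : ℕ) =
      (((m : ℝ) + 1) / (2 * Real.pi) : ℝ) * (1 + z) ^ m := by
  rw [Fin.sum_univ_eq_sum_range (fun k => (monomialWeight m k : ℂ) * z ^ k), add_comm 1 z, add_pow,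
    Finset.mul_sum]
  refine Finset.sum_congr rfl fun k _ => ?_
  rw [monomialWeight]
  push_cast
  ring

theorem coeFn_coherentState (m : ℕ) (w : ℂ) :
    ((coherentState m w : L2Sections m) : ℂ → ℂ) =ᵐ[sectionMeasure m] fun z =>
      (((m : ℝ) + 1) / (2 * Real.pi) : ℝ) * (1 + (starRingEnd ℂ) w * z) ^ m := by
  rw [coe_coherentState]
  filter_upwards [coeFn_sum_smul_monomialSection m fun k =>
    (monomialWeight m k : ℂ) * (starRingEnd ℂ) w ^ (k : ℕ)] with z hz
  rw [hz, ← sum_monomialWeight_mul_pow]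
  refine Finset.sum_congr rfl fun k _ => ?_
  ring

theorem norm_coherentState_sq (m : ℕ) (w : ℂ) :
    ‖coherentState m w‖ ^ 2 = ((m : ℝ) + 1) / (2 * Real.pi) * (1 + ‖w‖ ^ 2) ^ m := by
  have h : ((‖coherentState m w‖ ^ 2 : ℝ) : ℂ) =
      (((m : ℝ) + 1) / (2 * Real.pi) * (1 + ‖w‖ ^ 2) ^ m : ℝ) := by
    have h0 : (‖coherentState m w‖ : ℂ) ^ 2 = inner ℂ (coherentState m w) (coherentState m w) :=
      (inner_self_eq_norm_sq_to_K (𝕜 := ℂ) _).symm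
    push_cast
    rw [h0, Submodule.coe_inner]
    conv_lhs => arg 3; rw [coe_coherentState]
    rw [inner_coherentState_sum]
    have := sum_monomialWeight_mul_pow m ((starRingEnd ℂ) w * w)
    rw [Complex.conj_mul'] at this
    push_cast at this
    rw [← this]
    refine Finset.sum_congr rfl fun k _ => ?_
    rw [← Complex.conj_mul', mul_pow, mul_assoc]
  exact_mod_cast h

section

/-! ### The normalized area measure in the affine coordinate -/

/-- The normalized area measure `Ω / 2π` on the affine coordinate plane. -/
noncomputable def planeAreaMeasure : Measure ℂ :=
  ENNReal.ofReal (1 / (2 * Real.pi)) • fubiniStudy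

theorem map_planeAreaMeasure : planeAreaMeasure.map affineChart = areaMeasure := by
  rw [planeAreaMeasure, Measure.map_smul, areaMeasure]

instance : IsProbabilityMeasure planeAreaMeasure := by
  refine ⟨?_⟩
  have h : areaMeasure univ = 1 := measure_univ
  rwa [← map_planeAreaMeasure, Measure.map_apply continuous_affineChart.measurable
    MeasurableSet.univ, preimage_univ] at h

theorem integral_areaMeasure {u : CP1 → ℝ} (hu : Continuous u) :
    ∫ p, u p ∂areaMeasure = ∫ w, u (affineChart w) ∂planeAreaMeasure := by
  rw [← map_planeAreaMeasure, integral_map continuous_affineChart.measurable.aemeasurable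
    hu.measurable.aestronglyMeasurable]

theorem integral_sectionMeasure_eq_planeArea (m : ℕ) (u : ℂ → ℝ) :
    ∫ w, u w ∂sectionMeasure m =
      2 * Real.pi * ∫ w, 1 / (1 + ‖w‖ ^ 2) ^ m * u w ∂planeAreaMeasure := by
  have := Real.pi_pos
  rw [integral_sectionMeasure, planeAreaMeasure, integral_smul_measure,
    ENNReal.toReal_ofReal (by positivity), smul_eq_mul]
  simp only [smul_eq_mul]
  field_simp

/-! ### The Berezin transform -/

/-- The squared cosine `|1 + w̄z|² / ((1 + |w|²)(1 + |z|²))` of half the spherical distance. -/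
noncomputable def cosSq (w z : ℂ) : ℝ :=
  ‖1 + (starRingEnd ℂ) w * z‖ ^ 2 / ((1 + ‖w‖ ^ 2) * (1 + ‖z‖ ^ 2))

/-- The kernel of the Berezin transform with respect to the normalized area measure. -/
noncomputable def berezinKernel (m : ℕ) (w z : ℂ) : ℝ := ((m : ℝ) + 1) * cosSq w z ^ m

theorem cosSq_nonneg (w z : ℂ) : 0 ≤ cosSq w z := by
  rw [cosSq]
  positivity

theorem berezinKernel_nonneg (m : ℕ) (w z : ℂ) : 0 ≤ berezinKernel m w z :=
  mul_nonneg (by positivity) (pow_nonneg (cosSq_nonneg w z) m)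

theorem continuous_cosSq : Continuous fun p : ℂ × ℂ => cosSq p.1 p.2 := by
  have hc : Continuous fun p : ℂ × ℂ => (starRingEnd ℂ) p.1 :=
    Complex.continuous_conj.comp continuous_fst
  refine Continuous.div (((continuous_const.add (hc.mul continuous_snd)).norm).pow 2)
    (by fun_prop) fun p => ?_
  positivity

theorem continuous_berezinKernel (m : ℕ) : Continuous fun p : ℂ × ℂ => berezinKernel m p.1 p.2 :=
  continuous_const.mul (continuous_cosSq.pow m)

/-- Lagrange's identity; it gives 1 - `cosSq w z` = |z - w|² / ((1+|w|²)(1+|z|²)), so the kernel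
peaks exactly at z = w. -/
theorem norm_one_add_conj_mul_sq_add (w z : ℂ) :
    ‖1 + (starRingEnd ℂ) w * z‖ ^ 2 + ‖z - w‖ ^ 2 = (1 + ‖w‖ ^ 2) * (1 + ‖z‖ ^ 2) := by
  simp only [← Complex.normSq_eq_norm_sq, Complex.normSq_apply, Complex.add_re, Complex.add_im,
    Complex.mul_re, Complex.mul_im, Complex.conj_re, Complex.conj_im, Complex.sub_re,
    Complex.sub_im, Complex.one_re, Complex.one_im]
  ring

theorem exists_cosSq_le (w : ℂ) {δ : ℝ} (hδ : 0 < δ) :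
    ∃ r : ℝ, 0 ≤ r ∧ r < 1 ∧ ∀ z, δ ≤ ‖z - w‖ → cosSq w z ≤ r := by
  -- Chosen so that (1+|w|²)(1+|z|²) ≤ M|z - w|² whenever |z - w| ≥ δ, by |z|² ≤ 2|w|² + 2|z - w|².
  -- The bound r = 1 - 1/M is then uniform out to infinity.
  set M : ℝ := (1 + ‖w‖ ^ 2) * ((1 + 2 * ‖w‖ ^ 2) / δ ^ 2 + 2) with hM
  have hM1 : 1 < M := by
    have h1 : 0 < (1 + 2 * ‖w‖ ^ 2) / δ ^ 2 := by positivity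
    have h2 := sq_nonneg ‖w‖
    nlinarith
  refine ⟨1 - 1 / M, ?_, ?_, fun z hz => ?_⟩
  · rw [sub_nonneg, div_le_one (by linarith)]
    exact hM1.le
  · have : 0 < 1 / M := by positivity
    linarith
  · have h1 := norm_one_add_conj_mul_sq_add w z
    have hpos : 0 < (1 + ‖w‖ ^ 2) * (1 + ‖z‖ ^ 2) := by positivity
    have h2 : ‖z‖ ^ 2 ≤ 2 * ‖w‖ ^ 2 + 2 * ‖z - w‖ ^ 2 := by
      have h3 : ‖z‖ ≤ ‖w‖ + ‖z - w‖ := by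
        calc ‖z‖ = ‖w + (z - w)‖ := by congr 1; ring
          _ ≤ _ := norm_add_le _ _
      nlinarith [norm_nonneg z, norm_nonneg w, norm_nonneg (z - w), sq_nonneg (‖w‖ - ‖z - w‖)]
    have h4 : 1 + 2 * ‖w‖ ^ 2 ≤ ‖z - w‖ ^ 2 * ((1 + 2 * ‖w‖ ^ 2) / δ ^ 2) := by
      rw [mul_div_assoc', le_div_iff₀ (by positivity), mul_comm]
      gcongr
    have h5 : (1 + ‖w‖ ^ 2) * (1 + ‖z‖ ^ 2) ≤ ‖z - w‖ ^ 2 * M := by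
      calc (1 + ‖w‖ ^ 2) * (1 + ‖z‖ ^ 2)
          ≤ (1 + ‖w‖ ^ 2) * (‖z - w‖ ^ 2 * ((1 + 2 * ‖w‖ ^ 2) / δ ^ 2 + 2)) := by
            gcongr
            linarith
        _ = ‖z - w‖ ^ 2 * M := by rw [hM]; ring
    rw [cosSq, div_le_iff₀ hpos, sub_mul, one_mul, ← h1, one_div, h1]
    have h6 : M⁻¹ * ((1 + ‖w‖ ^ 2) * (1 + ‖z‖ ^ 2)) ≤ ‖z - w‖ ^ 2 := by
      rw [inv_mul_le_iff₀ (by linarith), mul_comm M]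
      exact h5
    linarith

/-- The Berezin kernel is the normalized density of the coherent state at w; taking u = 1 gives it
total mass 1. -/
theorem integral_mul_norm_coherentState_sq (m : ℕ) (w : ℂ) (u : ℂ → ℝ) :
    ∫ z, u z * ‖(coherentState m w : L2Sections m) z‖ ^ 2 ∂sectionMeasure m =
      ((m : ℝ) + 1) / (2 * Real.pi) * (1 + ‖w‖ ^ 2) ^ m *
        ∫ z, berezinKernel m w z * u z ∂planeAreaMeasure := by
  have hpi := Real.pi_pos
  have h1 : ∫ z, u z * ‖(coherentState m w : L2Sections m) z‖ ^ 2 ∂sectionMeasure m =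
      ∫ z, u z * ((((m : ℝ) + 1) / (2 * Real.pi)) ^ 2 *
        (‖1 + (starRingEnd ℂ) w * z‖ ^ 2) ^ m) ∂sectionMeasure m := by
    refine integral_congr_ae ?_
    filter_upwards [coeFn_coherentState m w] with z hz
    rw [hz, norm_mul, norm_pow, Complex.norm_real, Real.norm_of_nonneg (by positivity)]
    ring
  rw [h1, integral_sectionMeasure_eq_planeArea, ← integral_const_mul, ← integral_const_mul]
  refine integral_congr_ae (Eventually.of_forall fun z => ?_)
  simp only [berezinKernel, cosSq, div_pow, mul_pow]
  field_simp

theorem norm_sq_eq_integral (m : ℕ) (s : L2Sections m) :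
    ‖s‖ ^ 2 = ∫ z, ‖s z‖ ^ 2 ∂sectionMeasure m := by
  rw [← inner_self_eq_norm_sq (𝕜 := ℂ), L2.inner_def]
  have : ∫ z, inner ℂ (s z) (s z) ∂sectionMeasure m =
      ((∫ z, ‖s z‖ ^ 2 ∂sectionMeasure m : ℝ) : ℂ) := by
    rw [← integral_complex_ofReal]
    refine integral_congr_ae (Eventually.of_forall fun z => ?_)
    simp only [RCLike.inner_apply, Complex.mul_conj']
    push_cast
    rfl
  rw [this]
  rfl

theorem integral_berezinKernel (m : ℕ) (w : ℂ) :
    ∫ z, berezinKernel m w z ∂planeAreaMeasure = 1 := by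
  have hpi := Real.pi_pos
  have h := integral_mul_norm_coherentState_sq m w fun _ => 1
  simp only [one_mul, mul_one] at h
  rw [← norm_sq_eq_integral, Submodule.norm_coe, norm_coherentState_sq] at h
  refine mul_left_cancel₀ (a := ((m : ℝ) + 1) / (2 * Real.pi) * (1 + ‖w‖ ^ 2) ^ m) ?_
    (h.symm.trans (mul_one _).symm)
  positivity

theorem integrable_berezinKernel (m : ℕ) (w : ℂ) :
    Integrable (berezinKernel m w) planeAreaMeasure :=
  -- A non-integrable function has integral 0 by convention, so total mass 1 already gives
  -- integrability.
  Integrable.of_integral_ne_zero (by rw [integral_berezinKernel]; exact one_ne_zero)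

/-- The Berezin transforms of a bounded continuous function converge to it. -/
theorem tendsto_integral_berezinKernel {u : ℂ → ℝ} (hu : Continuous u) {C : ℝ}
    (hC : ∀ z, |u z| ≤ C) (w : ℂ) :
    Tendsto (fun m => ∫ z, berezinKernel m w z * u z ∂planeAreaMeasure) atTop (𝓝 (u w)) := by
  have h := tendsto_setIntegral_peak_smul_of_integrableOn_of_tendsto (μ := planeAreaMeasure)
    (φ := fun m => berezinKernel m w) (g := u) (l := atTop) (x₀ := w) (s := univ) (a := u w)
    MeasurableSet.univ (t := univ) MeasurableSet.univ subset_rfl univ_mem (measure_ne_top _ _)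
    (Eventually.of_forall fun m z _ => berezinKernel_nonneg m w z) ?_ ?_ ?_ ?_ ?_
  · simpa using h
  · intro v hv hwv
    obtain ⟨δ, hδ, hball⟩ := Metric.isOpen_iff.1 hv w hwv
    obtain ⟨r, hr0, hr1, hr⟩ := exists_cosSq_le w hδ
    -- Off the δ-ball the kernel is at most (m+1) r^m: geometric decay beats the normalizing factor.
    have hlim : Tendsto (fun m : ℕ => ((m : ℝ) + 1) * r ^ m) atTop (𝓝 0) := by
      have := (tendsto_self_mul_const_pow_of_lt_one hr0 hr1).add
        (tendsto_pow_atTop_nhds_zero_of_lt_one hr0 hr1)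
      rw [add_zero] at this
      refine this.congr fun m => ?_
      ring
    rw [Metric.tendstoUniformlyOn_iff]
    intro ε hε
    filter_upwards [hlim.eventually_lt_const hε] with m hm z hz
    rw [Pi.zero_apply, dist_zero_left, Real.norm_of_nonneg (berezinKernel_nonneg m w z)]
    refine lt_of_le_of_lt ?_ hm
    refine mul_le_mul_of_nonneg_left (pow_le_pow_left₀ (cosSq_nonneg w z) (hr z ?_) m)
      (by positivity)
    by_contra! hlt
    exact hz.2 (hball (by rwa [Metric.mem_ball, dist_eq_norm]))
  · simp only [Measure.restrict_univ, integral_berezinKernel]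
    exact tendsto_const_nhds
  · exact Eventually.of_forall fun m =>
      (integrable_berezinKernel m w).aestronglyMeasurable.restrict
  · exact (Integrable.of_bound hu.aestronglyMeasurable C (Eventually.of_forall hC)).integrableOn
  · exact (hu.tendsto w).mono_left nhdsWithin_le_nhds

theorem tendsto_integral_mul_integral_berezinKernel {u : ℂ → ℝ} (hu : Continuous u) {C : ℝ}
    (hC : ∀ z, |u z| ≤ C) :
    Tendsto (fun m => ∫ w, u w * ∫ z, berezinKernel m w z * u z ∂planeAreaMeasure
      ∂planeAreaMeasure) atTop (𝓝 (∫ w, u w ^ 2 ∂planeAreaMeasure)) := by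
  have hC0 : 0 ≤ C := (abs_nonneg _).trans (hC 0)
  refine tendsto_integral_of_dominated_convergence (fun _ => C * C) (fun m => ?_)
    (integrable_const _) (fun m => Eventually.of_forall fun w => ?_)
    (Eventually.of_forall fun w => ?_)
  · refine hu.aestronglyMeasurable.mul (StronglyMeasurable.aestronglyMeasurable ?_)
    refine StronglyMeasurable.integral_prod_right
      (f := fun w z => berezinKernel m w z * u z) (Continuous.stronglyMeasurable ?_)
    exact (continuous_berezinKernel m).mul (hu.comp continuous_snd)
  · rw [norm_mul]
    refine mul_le_mul (hC w) ?_ (norm_nonneg _) hC0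
    calc ‖∫ z, berezinKernel m w z * u z ∂planeAreaMeasure‖
        ≤ ∫ z, berezinKernel m w z * C ∂planeAreaMeasure := by
          refine norm_integral_le_of_norm_le ((integrable_berezinKernel m w).mul_const C)
            (Eventually.of_forall fun z => ?_)
          rw [norm_mul, Real.norm_of_nonneg (berezinKernel_nonneg m w z)]
          exact mul_le_mul_of_nonneg_left (hC z) (berezinKernel_nonneg m w z)
      _ = C := by rw [integral_mul_const, integral_berezinKernel, one_mul]
  · simp only [sq]
    exact (tendsto_integral_berezinKernel hu hC w).const_mul (u w)

/-! ### Eigenvalues of Toeplitz operators -/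

theorem integrable_mul_norm_sq {m : ℕ} {u : ℂ → ℝ} (hu : Continuous u) {C : ℝ}
    (hC : ∀ z, |u z| ≤ C) (s : L2Sections m) :
    Integrable (fun w => u w * ‖s w‖ ^ 2) (sectionMeasure m) :=
  ((Lp.memLp s).integrable_norm_pow two_ne_zero).bdd_mul hu.aestronglyMeasurable
    (Eventually.of_forall hC)

/-- By the reproducing property and Parseval, the sum of |e_k(w)|² is the squared norm of the
coherent state at w, whatever the basis; its growth cancels the weight (1+|w|²)^{-m} exactly. -/
theorem sum_integral_mul_norm_sq {m : ℕ} (e : OrthonormalBasis (Fin (m + 1)) ℂ (holSections m))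
    {u : ℂ → ℝ} (hu : Continuous u) {C : ℝ} (hC : ∀ z, |u z| ≤ C) :
    ∑ k, ∫ w, u w * ‖(e k : L2Sections m) w‖ ^ 2 ∂sectionMeasure m =
      ((m : ℝ) + 1) * ∫ w, u w ∂planeAreaMeasure := by
  have hpi := Real.pi_pos
  rw [← integral_finsetSum _ fun k _ => integrable_mul_norm_sq hu hC (e k : L2Sections m)]
  have h : ∀ᵐ w ∂sectionMeasure m, ∀ k,
      (e k : L2Sections m) w = inner ℂ (coherentState m w) (e k) := by
    rw [ae_all_iff]
    exact fun k => ae_eq_inner_coherentState m (e k)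
  have h2 : ∫ w, ∑ k, u w * ‖(e k : L2Sections m) w‖ ^ 2 ∂sectionMeasure m =
      ∫ w, u w * (((m : ℝ) + 1) / (2 * Real.pi) * (1 + ‖w‖ ^ 2) ^ m) ∂sectionMeasure m := by
    refine integral_congr_ae ?_
    filter_upwards [h] with w hw
    simp only [hw]
    rw [← Finset.mul_sum, e.sum_sq_norm_inner_left, norm_coherentState_sq]
  rw [h2, integral_sectionMeasure_eq_planeArea, ← integral_const_mul, ← integral_const_mul]
  refine integral_congr_ae (Eventually.of_forall fun w => ?_)
  simp only
  field_simp

variable {f : CP1 → ℝ} (hf : IsSmooth f) (m : ℕ)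

theorem inner_toeplitz_self (s : holSections m) :
    inner ℂ s (toeplitz f hf m s) =
      ((∫ w, f (affineChart w) * ‖(s : L2Sections m) w‖ ^ 2 ∂sectionMeasure m : ℝ) : ℂ) := by
  change inner ℂ s ((holSections m).orthogonalProjectionOnto (mulOperator f hf m s)) = _
  rw [Submodule.inner_orthogonalProjectionOnto_eq_of_mem_left, L2.inner_def,
    ← integral_complex_ofReal]
  refine integral_congr_ae ?_
  filter_upwards [(hf.memLp_mul (s : L2Sections m)).coeFn_toLp] with w h
  simp only [mulOperator, LinearMap.coe_mk, AddHom.coe_mk, h]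
  rw [RCLike.inner_apply, mul_assoc, Complex.mul_conj']
  push_cast
  rfl

/-- An orthonormal basis of eigenvectors of the Toeplitz operator. -/
noncomputable def toeplitzEigenbasis : OrthonormalBasis (Fin (m + 1)) ℂ (holSections m) :=
  (toeplitz_isSymmetric f hf m).eigenvectorBasis (finrank_holSections m)

theorem toeplitz_toeplitzEigenbasis (k : Fin (m + 1)) :
    toeplitz f hf m (toeplitzEigenbasis hf m k) =
      (toeplitzEigenvalues f hf m k : ℂ) • toeplitzEigenbasis hf m k :=
  (toeplitz_isSymmetric f hf m).apply_eigenvectorBasis (finrank_holSections m) k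

theorem toeplitzEigenvalues_eq_integral (k : Fin (m + 1)) :
    toeplitzEigenvalues f hf m k = ∫ w, f (affineChart w) *
      ‖(toeplitzEigenbasis hf m k : L2Sections m) w‖ ^ 2 ∂sectionMeasure m := by
  have h := inner_toeplitz_self hf m (toeplitzEigenbasis hf m k)
  have h1 : inner ℂ (toeplitzEigenbasis hf m k)
      ((toeplitzEigenvalues f hf m k : ℂ) • toeplitzEigenbasis hf m k) =
        toeplitzEigenvalues f hf m k * inner ℂ (toeplitzEigenbasis hf m k)
          (toeplitzEigenbasis hf m k) :=
    inner_smul_right (𝕜 := ℂ) (E := holSections m) _ _ _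
  rw [toeplitz_toeplitzEigenbasis, h1, inner_self_eq_norm_sq_to_K (𝕜 := ℂ) (E := holSections m),
    (toeplitzEigenbasis hf m).norm_eq_one] at h
  simp only [RCLike.ofReal_one, one_pow, mul_one] at h
  exact_mod_cast h

theorem integral_norm_toeplitzEigenbasis_sq (k : Fin (m + 1)) :
    ∫ w, ‖(toeplitzEigenbasis hf m k : L2Sections m) w‖ ^ 2 ∂sectionMeasure m = 1 := by
  rw [← norm_sq_eq_integral, Submodule.norm_coe, (toeplitzEigenbasis hf m).norm_eq_one, one_pow]

/-- The upper Berezin-Lieb inequality for the functions `x ↦ (x - t)⁺`. -/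
theorem sum_toeplitzEigenvalues_pos_part_le (t : ℝ) :
    ∑ k, max (toeplitzEigenvalues f hf m k - t) 0 ≤
      ((m : ℝ) + 1) * ∫ p, max (f p - t) 0 ∂areaMeasure := by
  obtain ⟨C, hC0, hC⟩ := hf.bounded
  have hfc : Continuous fun w => f (affineChart w) := hf.1.continuous
  have hu : Continuous fun w => max (f (affineChart w) - t) 0 :=
    (hfc.sub continuous_const).max continuous_const
  have hb : ∀ w, |max (f (affineChart w) - t) 0| ≤ C + |t| := fun w => by
    rw [abs_of_nonneg (le_max_right _ _)]
    refine max_le ?_ (by positivity)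
    linarith [(abs_le.1 (hC (affineChart w))).2, neg_abs_le t]
  rw [integral_areaMeasure (u := fun p => max (f p - t) 0)
    ((hf.continuous.sub continuous_const).max continuous_const),
    ← sum_integral_mul_norm_sq (toeplitzEigenbasis hf m) hu hb]
  -- Jensen by hand: the eigenvalue minus t is the mean of f - t against the probability density
  -- |e_k|², hence at most the mean of (f - t)⁺, which is nonnegative.
  refine Finset.sum_le_sum fun k _ => max_le ?_ ?_
  · have h1 := integrable_mul_norm_sq hfc (fun w => hC (affineChart w))
      (toeplitzEigenbasis hf m k : L2Sections m)
    have h2 := integrable_mul_norm_sq (continuous_const (y := t)) (fun _ => le_rfl)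
      (toeplitzEigenbasis hf m k : L2Sections m)
    have h3 : toeplitzEigenvalues f hf m k - t = ∫ w, (f (affineChart w) *
        ‖(toeplitzEigenbasis hf m k : L2Sections m) w‖ ^ 2 -
          t * ‖(toeplitzEigenbasis hf m k : L2Sections m) w‖ ^ 2) ∂sectionMeasure m := by
      rw [integral_sub h1 h2, integral_const_mul, integral_norm_toeplitzEigenbasis_sq, mul_one,
        ← toeplitzEigenvalues_eq_integral]
    rw [h3]
    refine integral_mono (h1.sub h2) (integrable_mul_norm_sq hu hb _) fun w => ?_
    simp only [← sub_mul]
    exact mul_le_mul_of_nonneg_right (le_max_left _ _) (sq_nonneg _)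
  · exact integral_nonneg fun w => mul_nonneg (le_max_right _ _) (sq_nonneg _)

theorem sum_toeplitzEigenvalues :
    ∑ k, toeplitzEigenvalues f hf m k = ((m : ℝ) + 1) * ∫ p, f p ∂areaMeasure := by
  obtain ⟨C, -, hC⟩ := hf.bounded
  rw [integral_areaMeasure hf.continuous, ← sum_integral_mul_norm_sq (toeplitzEigenbasis hf m)
    hf.1.continuous fun w => hC (affineChart w)]
  exact Finset.sum_congr rfl fun k _ => toeplitzEigenvalues_eq_integral hf m k

theorem stepMap_toeplitzEigenvalues_mem :
    stepMap m (toeplitzEigenvalues f hf m) ∈ majorizedSet f := by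
  rw [mem_majorizedSet_iff hf]
  have hm : (0 : ℝ) < (m : ℝ) + 1 := by positivity
  constructor
  · intro t
    rw [integral_comp_stepMap _ fun y => max (y - t) 0, one_div, inv_mul_le_iff₀ hm]
    exact sum_toeplitzEigenvalues_pos_part_le hf m t
  · refine (integral_comp_stepMap _ id).trans ?_
    simp only [id]
    rw [sum_toeplitzEigenvalues, one_div, inv_mul_cancel_left₀ hm.ne']

theorem sum_toeplitzEigenvalues_mul_norm_inner_sq (s : holSections m) :
    ∑ k, toeplitzEigenvalues f hf m k * ‖inner ℂ s (toeplitzEigenbasis hf m k)‖ ^ 2 =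
      ∫ w, f (affineChart w) * ‖(s : L2Sections m) w‖ ^ 2 ∂sectionMeasure m := by
  have h := inner_toeplitz_self hf m s
  rw [← (toeplitzEigenbasis hf m).sum_inner_mul_inner] at h
  have h2 : ∀ k, inner ℂ s (toeplitzEigenbasis hf m k) *
      inner ℂ (toeplitzEigenbasis hf m k) (toeplitz f hf m s) =
        ((toeplitzEigenvalues f hf m k * ‖inner ℂ s (toeplitzEigenbasis hf m k)‖ ^ 2 : ℝ) : ℂ) := by
    intro k
    have h1 : inner ℂ ((toeplitzEigenvalues f hf m k : ℂ) • toeplitzEigenbasis hf m k) s =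
        (starRingEnd ℂ) (toeplitzEigenvalues f hf m k : ℂ) *
          inner ℂ (toeplitzEigenbasis hf m k) s :=
      inner_smul_left (𝕜 := ℂ) (E := holSections m) _ _ _
    rw [← toeplitz_isSymmetric f hf m, toeplitz_toeplitzEigenbasis, h1,
      Complex.conj_ofReal, ← inner_conj_symm (toeplitzEigenbasis hf m k) s, mul_left_comm,
      Complex.mul_conj']
    push_cast
    rfl
  simp only [h2] at h
  exact_mod_cast h

/-- Write one factor λ_k as the integral of f|e_k|² and e_k(w) as ⟨K_w, e_k⟩, where K_w is the
coherent state. The remaining sum of λ_k |⟨K_w, e_k⟩|² is ⟨K_w, T_f K_w⟩, a multiple of the Berezin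
transform of f at w. -/
theorem sum_toeplitzEigenvalues_sq :
    ∑ k, toeplitzEigenvalues f hf m k ^ 2 = ((m : ℝ) + 1) * ∫ w, f (affineChart w) *
      ∫ z, berezinKernel m w z * f (affineChart z) ∂planeAreaMeasure ∂planeAreaMeasure := by
  obtain ⟨C, -, hC⟩ := hf.bounded
  have hpi := Real.pi_pos
  have hint := fun k => integrable_mul_norm_sq hf.1.continuous (fun w => hC (affineChart w))
      (toeplitzEigenbasis hf m k : L2Sections m)
  have h1 : ∑ k, toeplitzEigenvalues f hf m k ^ 2 = ∫ w, ∑ k, toeplitzEigenvalues f hf m k *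
      (f (affineChart w) * ‖(toeplitzEigenbasis hf m k : L2Sections m) w‖ ^ 2)
        ∂sectionMeasure m := by
    rw [integral_finsetSum _ fun k _ => (hint k).const_mul _]
    refine Finset.sum_congr rfl fun k _ => ?_
    rw [integral_const_mul, ← toeplitzEigenvalues_eq_integral, sq]
  have h : ∀ᵐ w ∂sectionMeasure m, ∀ k, (toeplitzEigenbasis hf m k : L2Sections m) w =
      inner ℂ (coherentState m w) (toeplitzEigenbasis hf m k) := by
    rw [ae_all_iff]
    exact fun k => ae_eq_inner_coherentState m _
  have h2 : ∑ k, toeplitzEigenvalues f hf m k ^ 2 = ∫ w, f (affineChart w) *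
      (((m : ℝ) + 1) / (2 * Real.pi) * (1 + ‖w‖ ^ 2) ^ m *
        ∫ z, berezinKernel m w z * f (affineChart z) ∂planeAreaMeasure) ∂sectionMeasure m := by
    rw [h1]
    refine integral_congr_ae ?_
    filter_upwards [h] with w hw
    simp only [hw, mul_left_comm _ (f (affineChart w))]
    rw [← Finset.mul_sum, sum_toeplitzEigenvalues_mul_norm_inner_sq,
      integral_mul_norm_coherentState_sq]
  rw [h2, integral_sectionMeasure_eq_planeArea, ← integral_const_mul, ← integral_const_mul]
  refine integral_congr_ae (Eventually.of_forall fun w => ?_)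
  simp only
  field_simp

theorem tendsto_sum_toeplitzEigenvalues_sq :
    Tendsto (fun m : ℕ => 1 / ((m : ℝ) + 1) * ∑ k, toeplitzEigenvalues f hf m k ^ 2) atTop
      (𝓝 (∫ p, f p ^ 2 ∂areaMeasure)) := by
  obtain ⟨C, -, hC⟩ := hf.bounded
  rw [integral_areaMeasure (u := fun p => f p ^ 2) (hf.continuous.pow 2)]
  refine (tendsto_integral_mul_integral_berezinKernel hf.1.continuous
    fun w => hC (affineChart w)).congr fun m => ?_
  rw [sum_toeplitzEigenvalues_sq, one_div, inv_mul_cancel_left₀ (by positivity)]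

end

end ToeplitzConvexity

/-! ### The main theorem -/

theorem mainTheorem1 (f : CP1 → ℝ) (hf : IsSmooth f) :
    weakClosure (topLimsup (stepSet f hf)) = majorizedSet f ∧
      closedConvexHull ℝ (smeasOrbit f hf) = weakClosure (topLimsup (stepSet f hf)) := by
  have h : weakClosure (topLimsup (stepSet f hf)) = majorizedSet f := by
    refine (weakClosure_subset (convex_majorizedSet hf) (isClosed_majorizedSet hf)
      (topLimsup_subset (isClosed_majorizedSet hf) fun m => image_permutohedron_subset hf
        (stepMap_toeplitzEigenvalues_mem hf m))).antisymm ?_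
    exact (majorizedSet_subset_topLimsup hf
      (fun m => (toeplitz_isSymmetric f hf m).eigenvalues_antitone (finrank_holSections m))
      (stepMap_toeplitzEigenvalues_mem hf) (tendsto_sum_toeplitzEigenvalues_sq hf)).trans
      (subset_weakClosure _)
  exact ⟨h, (closedConvexHull_smeasOrbit hf).trans h.symm⟩
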